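/- Let $X$ be a smooth, connected, finite-dimensional Riemannian manifold without boundary, with metric $\langle\cdot,\cdot\rangle_g$ and norm $|\cdot|_g$, which is complete for its Riemannian distance $d$. Let $F:X\to\mathbb R$ be smooth, let $\lambda\in\mathbb R$, and let $S_t:X\to X$, $t\ge 0$, be a smooth semigroup: $S_0(u)=u$ and $S_{t+h}(u)=S_h(S_t(u))$ for all $u\in X$ and $t,h\ge0$, and $(t,u)\mapsto S_t(u)$ is smooth on $[0,\infty)\times X$. For a smooth curve $\gamma:[0,1]\to X$, $s\mapsto\gamma^s$, put $$\tilde\gamma^s_t:=S_{st}(\gamma^s),\qquad \tilde A^s_t:=\big|\partial_s\tilde\gamma^s_t\big|_g^2,\qquad \tilde F^s_t:=F(\tilde\gamma^s_t),\qquad s\in[0,1],\ t\ge0,$$ and consider the inequality $$\frac12\,\frac{\partial}{\partial t}\tilde A^s_t+\frac{\partial}{\partial s}\tilde F^s_t\le-\lambda\,s\,\tilde A^s_t \qquad(\ast)$$ (with one-sided derivatives at $t=0$ and at $s=0,1$). 1. Suppose that for every smooth curve $\gamma:[0,1]\to X$ the inequality $(\ast)$ holds for all $s\in[0,1]$ and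 all $t\ge0$. Then: - (Evolution Variational Inequality) for all $u,v\in X$ and all $t\ge0$, $$\frac12\frac{d^+}{dt}d^2(S_t(u),v)+\frac\lambda2\,d^2(S_t(u),v)+F(S_t(u))\le F(v),\qquad \frac{d^+}{dt}\zeta(t):=\limsup_{h\downarrow0}\frac{\zeta(t+h)-\zeta(t)}{h};$$ - $S$ is the gradient flow of $F$: for every $u\in X$ the curve $u_t:=S_t(u)$ solves $\dot u_t=-\nabla F(u_t)$ for all $t\ge0$, with $u_0=u$; - $F$ is geodesically $\lambda$-convex: for every minimal constant speed geodesic $\gamma:[0,1]\to X$, i.e. every curve with $d(\gamma^r,\gamma^s)=|r-s|\,d(\gamma^0,\gamma^1)$ for all $r,s\in[0,1]$, $$F(\gamma^s)\le(1-s)F(\gamma^0)+sF(\gamma^1)-\frac\lambda2\,s(1-s)\,d^2(\gamma^0,\gamma^1)\qquad\forall\,s\in[0,1].$$ 2. It is sufficient to check $(\ast)$ at $t=0$: if for every smooth curve $\gamma:[0,1]\to X$ the inequality $(\ast)$ holds at $t=0$ for all $s\in[0,1]$, then for every smooth curve it holds for all $s\in[0,1]$ and all $t\ge0$. -/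

import Mathlib

open Set Filter Manifold Bundle
open scoped Topology ContDiff

noncomputable section

namespace ActionFlow

/-- The upper right Dini derivative `d⁺ζ/dt (t) = limsup_{h ↓ 0} (ζ (t + h) - ζ t) / h`, with values
in the extended reals, so that the upper limit always exists. -/
def upperRightDeriv (ζ : ℝ → ℝ) (t : ℝ) : EReal :=
  limsup (fun h : ℝ => (((ζ (t + h) - ζ t) / h : ℝ) : EReal)) (𝓝[>] 0)

section Metric

variable {X : Type*} [MetricSpace X]

/-- The Evolution Variational Inequality for the maps `S t`, `t ≥ 0`, and the functional `F`. -/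
def SatisfiesEVI (F : X → ℝ) (lam : ℝ) (S : ℝ → X → X) : Prop :=
  ∀ u v : X, ∀ t : ℝ, 0 ≤ t →
    ((1 / 2 : ℝ) : EReal) * upperRightDeriv (fun r => dist (S r u) v ^ 2) t
      + ((lam / 2 * dist (S t u) v ^ 2 + F (S t u) : ℝ) : EReal) ≤ ((F v : ℝ) : EReal)

/-- `γ`, restricted to `[0,1]`, is a minimal geodesic with constant speed. -/
def IsMinGeodesic (γ : ℝ → X) : Prop :=
  ∀ r ∈ Icc (0 : ℝ) 1, ∀ s ∈ Icc (0 : ℝ) 1, dist (γ r) (γ s) = |r - s| * dist (γ 0) (γ 1)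

/-- (Strong) geodesic `lam`-convexity: the convexity inequality holds along every minimal
constant speed geodesic. -/
def GeodesicallyConvex (F : X → ℝ) (lam : ℝ) : Prop :=
  ∀ γ : ℝ → X, IsMinGeodesic γ → ∀ s ∈ Icc (0 : ℝ) 1,
    F (γ s) ≤ (1 - s) * F (γ 0) + s * F (γ 1)
      - lam / 2 * s * (1 - s) * dist (γ 0) (γ 1) ^ 2

end Metric

section Manifold

variable (E : Type*) [NormedAddCommGroup E] [NormedSpace ℝ E]
  {X : Type*} [TopologicalSpace X] [ChartedSpace E X]

/-- A smooth semigroup of maps `S t : X → X`, `t ≥ 0`; the values for `t < 0` are irrelevant. -/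
structure IsSmoothSemigroup (S : ℝ → X → X) : Prop where
  zero : ∀ u, S 0 u = u
  add : ∀ t h, 0 ≤ t → 0 ≤ h → ∀ u, S (t + h) u = S h (S t u)
  smooth : ContMDiffOn (𝓘(ℝ, ℝ).prod 𝓘(ℝ, E)) 𝓘(ℝ, E) ∞
    (fun p : ℝ × X => S p.1 p.2) (Ici 0 ×ˢ univ)

/-- The deformation `γ̃ˢₜ = S_{st}(γˢ)` of a curve `γ`. -/
def deform (S : ℝ → X → X) (γ : ℝ → X) (t s : ℝ) : X := S (s * t) (γ s)

variable [IsManifold 𝓘(ℝ, E) ∞ X] [RiemannianBundle (fun x : X => TangentSpace 𝓘(ℝ, E) x)]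

/-- `Ãˢₜ = |∂ₛ γ̃ˢₜ|²`, the squared Riemannian norm of the velocity in `s ∈ [0,1]` of `γ̃ₜ`. -/
def action (S : ℝ → X → X) (γ : ℝ → X) (t s : ℝ) : ℝ :=
  ‖mfderivWithin 𝓘(ℝ, ℝ) 𝓘(ℝ, E) (deform S γ t) (Icc 0 1) s (1 : TangentSpace 𝓘(ℝ, ℝ) s)‖ ^ 2

/-- For every smooth curve `γ : [0,1] → X` the inequality
`½ ∂ₜ Ãˢₜ + ∂ₛ F(γ̃ˢₜ) ≤ -lam s Ãˢₜ` holds for all `s ∈ [0,1]` at the time `t`. -/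
def ActionInequalityAt (F : X → ℝ) (lam : ℝ) (S : ℝ → X → X) (t : ℝ) : Prop :=
  ∀ γ : ℝ → X, ContMDiffOn 𝓘(ℝ, ℝ) 𝓘(ℝ, E) ∞ γ (Icc 0 1) → ∀ s ∈ Icc (0 : ℝ) 1,
    1 / 2 * derivWithin (fun r => action E S γ r s) (Ici 0) t
      + derivWithin (fun σ => F (deform S γ t σ)) (Icc 0 1) s ≤ -lam * s * action E S γ t s

variable [FiniteDimensional ℝ E]

/-- The Riemannian gradient: the tangent vector at `x` that represents the differential of `F` at
`x` in the inner product of the tangent space. -/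
def grad (F : X → ℝ) (x : X) : TangentSpace 𝓘(ℝ, E) x :=
  haveI : FiniteDimensional ℝ (TangentSpace 𝓘(ℝ, E) x) := inferInstanceAs (FiniteDimensional ℝ E)
  haveI : CompleteSpace (TangentSpace 𝓘(ℝ, E) x) := FiniteDimensional.complete ℝ _
  (InnerProductSpace.toDual ℝ (TangentSpace 𝓘(ℝ, E) x)).symm
    (mfderiv 𝓘(ℝ, E) 𝓘(ℝ, ℝ) F x : TangentSpace 𝓘(ℝ, E) x →L[ℝ] ℝ)

/-- `t ↦ S t u` solves `u̇ₜ = -∇F(uₜ)` for `t ≥ 0`, with initial datum `u`, for every `u`. -/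
def IsGradientFlow (F : X → ℝ) (S : ℝ → X → X) : Prop :=
  ∀ u : X, S 0 u = u ∧
    IsMIntegralCurveOn (I := 𝓘(ℝ, E)) (fun t => S t u) (fun x => -grad E F x) (Ici 0)

end Manifold

end ActionFlow

end

noncomputable section

namespace ActionFlow

/-! Join `v = γ 0` to `u = γ 1` by a smooth curve. The deformation `S (s * t) (γ s)` fixes the end
`s = 0` and moves the end `s = 1` along the trajectory of `u`, so its energy, the integral of the
action over `s`, bounds `dist (S t u) v ^ 2` from above. Integrating the action inequality in `s`
bounds half the growth rate of the energy by `F v - F (S t u)` minus `lam` times the integral of `s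
* action`. The weight `1 + 2 * lam * s * t` absorbs the last term to first order in `t`
(`weighted_energy_le`), and Cauchy–Schwarz bounds the weighted energy at time `h` below by the
squared distance times `1 + lam * h - O(h ^ 2)` (`sq_mul_le_weighted_energy`). If the initial energy
is arbitrarily close to `dist u v ^ 2`, with errors uniform in the curve, this is the EVI up to `O(h
^ 2)` (`exists_dist_sq_le`), and `h → 0` concludes.

Geodesics are never constructed: smooth curves of speed at most any `k > dist v u` suffice.
`smoothlyJoined_of_dist_lt` chains chart segments, with compactness of balls (Hopf–Rinow) giving a
uniform scale.

At `s = t = 0` the action inequality reads `⟨V, w⟩ + dF w ≤ 0`, where `V` is the generator and `w`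
the initial velocity of the curve. As `w` is arbitrary, `V = -∇F`.

Convexity follows from the EVI estimates at a point of a geodesic relative to both endpoints,
because that point minimises the weighted sum of squared distances to them. Part 2 holds because
deforming for time `t` and then `h` is deforming for time `t + h`. -/

/-- A metric space has approximate splittings if every distance `dist x y < a + b` is realised by an
intermediate point at distances at most `a` and `b` from the endpoints. -/
def HasApproxSplitting (X : Type*) [PseudoMetricSpace X] : Prop :=
  ∀ x y : X, ∀ a b : ℝ, 0 ≤ a → 0 < b → dist x y < a + b →
    ∃ z, dist x z ≤ a ∧ dist z y < b

/-! ### Hopf–Rinow: compactness of closed balls. -/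

section Metric

variable {X : Type*} [MetricSpace X]

/-- Points of the large ball lie within `ε / 2` of a slightly smaller compact ball, so an `ε /
2`-net of the smaller is an `ε`-net of the larger. -/
lemma HasApproxSplitting.isCompact_closedBall_of_forall_lt [CompleteSpace X]
    (hX : HasApproxSplitting X) (x : X) {R : ℝ} (hR : 0 < R)
    (h : ∀ r, 0 ≤ r → r < R → IsCompact (Metric.closedBall x r)) :
    IsCompact (Metric.closedBall x R) := by
  refine TotallyBounded.isCompact_of_isClosed ?_ Metric.isClosed_closedBall
  rw [Metric.totallyBounded_iff]
  intro ε hε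
  set r := max 0 (R - ε / 4) with hr
  have hr0 : 0 ≤ r := le_max_left _ _
  have hrR : r < R := max_lt hR (by linarith)
  obtain ⟨t, ht, htc⟩ := Metric.totallyBounded_iff.1 (h r hr0 hrR).totallyBounded (ε / 2)
    (by positivity)
  refine ⟨t, ht, fun y hy => ?_⟩
  have hy' : dist x y < r + ε / 2 := by
    have := Metric.mem_closedBall'.1 hy
    have := le_max_right 0 (R - ε / 4)
    linarith
  obtain ⟨z, hz, hzy⟩ := hX x y r (ε / 2) hr0 (by positivity) hy'
  have hz' := htc (Metric.mem_closedBall'.2 hz)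
  simp only [mem_iUnion, Metric.mem_ball, exists_prop] at hz' ⊢
  obtain ⟨p, hp, hpz⟩ := hz'
  refine ⟨p, hp, ?_⟩
  have := dist_triangle y z p
  rw [dist_comm y z] at this
  linarith

lemma HasApproxSplitting.exists_isCompact_closedBall_add [LocallyCompactSpace X]
    (hX : HasApproxSplitting X) (x : X) {r : ℝ} (hr : 0 ≤ r)
    (h : IsCompact (Metric.closedBall x r)) :
    ∃ δ > 0, IsCompact (Metric.closedBall x (r + δ)) := by
  obtain ⟨K, hK, hsub⟩ := exists_compact_superset h
  obtain ⟨δ, hδ, hδK⟩ := h.exists_thickening_subset_open isOpen_interior hsub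
  refine ⟨δ / 2, by positivity, hK.of_isClosed_subset Metric.isClosed_closedBall fun y hy => ?_⟩
  obtain ⟨z, hz, hzy⟩ := hX x y r δ hr hδ (by
    have := Metric.mem_closedBall'.1 hy
    linarith)
  refine interior_subset (hδK (Metric.mem_thickening_iff.2 ⟨z, Metric.mem_closedBall'.2 hz, ?_⟩))
  rwa [dist_comm]

/-- The theorem of Hopf-Rinow and Cohn-Vossen: complete locally compact length spaces are proper. -/
lemma HasApproxSplitting.properSpace [CompleteSpace X] [LocallyCompactSpace X]
    (hX : HasApproxSplitting X) : ProperSpace X := by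
  refine ⟨fun x R => ?_⟩
  by_contra hcon
  -- The infimum of the bad radii is itself a good radius, and so are slightly larger ones, which is
  -- absurd.
  set B : Set ℝ := {r | 0 ≤ r ∧ ¬ IsCompact (Metric.closedBall x r)} with hB
  have hR : 0 ≤ R := by
    by_contra hR
    rw [Metric.closedBall_eq_empty.2 (not_le.1 hR)] at hcon
    exact hcon isCompact_empty
  have hne : B.Nonempty := ⟨R, hR, hcon⟩
  have hbdd : BddBelow B := ⟨0, fun r hr => hr.1⟩
  set ρ := sInf B
  have hρ0 : 0 ≤ ρ := le_csInf hne fun r hr => hr.1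
  have hlt : ∀ r, 0 ≤ r → r < ρ → IsCompact (Metric.closedBall x r) := fun r h0 hr => by
    by_contra hc
    exact absurd (csInf_le hbdd ⟨h0, hc⟩) (not_le.2 hr)
  have hcomp : IsCompact (Metric.closedBall x ρ) := by
    rcases hρ0.eq_or_lt with h | h
    · rw [← h, Metric.closedBall_zero]
      exact isCompact_singleton
    · exact hX.isCompact_closedBall_of_forall_lt x h hlt
  obtain ⟨δ, hδ, hc⟩ := hX.exists_isCompact_closedBall_add x hρ0 hcomp
  obtain ⟨r, hr, hrδ⟩ := exists_lt_of_csInf_lt hne (show sInf B < ρ + δ by linarith)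
  exact hr.2 (hc.of_isClosed_subset Metric.isClosed_closedBall
    (Metric.closedBall_subset_closedBall hrδ.le))

end Metric

/-! ### Riemannian distance and path length. -/

section Riemannian

variable {E : Type*} [NormedAddCommGroup E] [NormedSpace ℝ E]
  {X : Type*} [MetricSpace X] [ChartedSpace E X]
  [RiemannianBundle (fun x : X => TangentSpace 𝓘(ℝ, E) x)]
  [IsRiemannianManifold 𝓘(ℝ, E) X]

variable (E) in
lemma edist_le_pathELength {γ : ℝ → X} {a b : ℝ} (hγ : ContMDiffOn 𝓘(ℝ, ℝ) 𝓘(ℝ, E) 1 γ (Icc a b))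
    (hab : a ≤ b) : edist (γ a) (γ b) ≤ pathELength 𝓘(ℝ, E) γ a b := by
  rw [IsRiemannianManifold.out (I := 𝓘(ℝ, E)) (γ a) (γ b)]
  exact riemannianEDist_le_pathELength hγ rfl rfl hab

variable (E) in
lemma exists_path_of_dist_lt {x y : X} {L : ℝ} (h : dist x y < L) :
    ∃ γ : ℝ → X, γ 0 = x ∧ γ 1 = y ∧ ContMDiffOn 𝓘(ℝ, ℝ) 𝓘(ℝ, E) 1 γ (Icc 0 1) ∧
      pathELength 𝓘(ℝ, E) γ 0 1 < ENNReal.ofReal L := by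
  apply exists_lt_of_riemannianEDist_lt
  rw [← IsRiemannianManifold.out (I := 𝓘(ℝ, E)) x y, edist_dist]
  exact (ENNReal.ofReal_lt_ofReal_iff (dist_nonneg.trans_lt h)).2 h

/-- On a path of length below `a + b`, take a point at distance exactly `a` from `x`; less than `b`
of the length is left for the rest. -/
lemma hasApproxSplitting (E : Type*) [NormedAddCommGroup E] [NormedSpace ℝ E]
    (X : Type*) [MetricSpace X] [ChartedSpace E X]
    [RiemannianBundle (fun x : X => TangentSpace 𝓘(ℝ, E) x)]
    [IsRiemannianManifold 𝓘(ℝ, E) X] : HasApproxSplitting X := by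
  intro x y a b ha hb hxy
  rcases le_or_gt (dist x y) a with h | h
  · exact ⟨y, h, by simpa using hb⟩
  obtain ⟨γ, h0, h1, hγ, hL⟩ := exists_path_of_dist_lt E hxy
  have hc : ContinuousOn (fun s => dist x (γ s)) (Icc 0 1) :=
    (continuous_const.dist continuous_id).comp_continuousOn hγ.continuousOn
  obtain ⟨s, hs, hsa⟩ : a ∈ (fun s => dist x (γ s)) '' Icc 0 1 :=
    intermediate_value_Icc zero_le_one hc ⟨by simpa [h0] using ha, by simpa [h1] using h.le⟩
  refine ⟨γ s, hsa.le, ?_⟩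
  rw [← pathELength_add hs.1 hs.2] at hL
  have e1 := edist_le_pathELength E (hγ.mono (Icc_subset_Icc_right hs.2)) hs.1
  have e2 := edist_le_pathELength E (hγ.mono (Icc_subset_Icc_left hs.1)) hs.2
  have := (add_le_add e1 e2).trans_lt hL
  rw [h0, h1, edist_dist, edist_dist, ← ENNReal.ofReal_add dist_nonneg dist_nonneg,
    ENNReal.ofReal_lt_ofReal_iff (by linarith)] at this
  simp only at hsa
  linarith

end Riemannian

/-! ### The metric read in a chart. -/

section Local

variable {E : Type*} [NormedAddCommGroup E] [NormedSpace ℝ E]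
  {X : Type*} [MetricSpace X] [ChartedSpace E X] [IsManifold 𝓘(ℝ, E) ∞ X]

/-- The derivative of a curve read in a chart. -/
lemma mfderivWithin_extChartAt_comp {x₀ : X} {γ : ℝ → X} {t : Set ℝ} {s : ℝ}
    (hγ : MDifferentiableWithinAt 𝓘(ℝ, ℝ) 𝓘(ℝ, E) γ t s) (ht : UniqueDiffWithinAt ℝ t s)
    (hs : γ s ∈ (chartAt E x₀).source) :
    mfderiv 𝓘(ℝ, E) 𝓘(ℝ, E) (extChartAt 𝓘(ℝ, E) x₀) (γ s)
      (mfderivWithin 𝓘(ℝ, ℝ) 𝓘(ℝ, E) γ t s (1 : ℝ)) =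
      derivWithin (fun σ => extChartAt 𝓘(ℝ, E) x₀ (γ σ)) t s := by
  have h : mfderivWithin 𝓘(ℝ, ℝ) 𝓘(ℝ, E) (extChartAt 𝓘(ℝ, E) x₀ ∘ γ) t s =
      (mfderiv 𝓘(ℝ, E) 𝓘(ℝ, E) (extChartAt 𝓘(ℝ, E) x₀) (γ s)) ∘L
        (mfderivWithin 𝓘(ℝ, ℝ) 𝓘(ℝ, E) γ t s) :=
    mfderiv_comp_mfderivWithin _ (mdifferentiableAt_extChartAt hs) hγ
      (uniqueMDiffWithinAt_iff_uniqueDiffWithinAt.2 ht)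
  rw [mfderivWithin_eq_fderivWithin] at h
  rw [← fderivWithin_derivWithin]
  exact (congrArg (fun L : ℝ →L[ℝ] E => L 1) h).symm

variable [RiemannianBundle (fun x : X => TangentSpace 𝓘(ℝ, E) x)]

variable (E) in
lemma norm_chart_sub_le_of_pathELength_lt {x₀ : X} {r L : ℝ} (hr : 0 < r)
    (P : E →L[ℝ] TangentSpace 𝓘(ℝ, E) x₀) {c : ℝ → X}
    (hc : ContMDiffOn 𝓘(ℝ, ℝ) 𝓘(ℝ, E) 1 c (Icc 0 1))
    (hsource : ∀ s ∈ Icc (0 : ℝ) 1, c s ∈ (chartAt E x₀).source)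
    (hP : ∀ s ∈ Icc (0 : ℝ) 1, ∀ v : TangentSpace 𝓘(ℝ, E) (c s),
      ‖P (mfderiv 𝓘(ℝ, E) 𝓘(ℝ, E) (extChartAt 𝓘(ℝ, E) x₀) (c s) v)‖ ≤ r * ‖v‖)
    (hL : pathELength 𝓘(ℝ, E) c 0 1 < ENNReal.ofReal L) :
    ‖P (extChartAt 𝓘(ℝ, E) x₀ (c 1) - extChartAt 𝓘(ℝ, E) x₀ (c 0))‖ ≤ r * L := by
  have hL0 : 0 < L := ENNReal.ofReal_pos.1 (pos_of_gt hL)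
  set f : ℝ → E := fun s => extChartAt 𝓘(ℝ, E) x₀ (c s) with hf
  have hfd : ContDiffOn ℝ 1 f (Icc 0 1) := by
    rw [← contMDiffOn_iff_contDiffOn]
    exact (contMDiffOn_extChartAt (n := 1)).comp hc hsource
  have hPf : ContDiffOn ℝ 1 (fun s => P (f s)) (Icc 0 1) := P.contDiff.comp_contDiffOn hfd
  have key := enorm_sub_le_lintegral_derivWithin_Icc_of_contDiffOn_Icc hPf zero_le_one
  have hbound : ∫⁻ s in Icc (0 : ℝ) 1, ‖derivWithin (fun s => P (f s)) (Icc 0 1) s‖ₑ ≤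
      ∫⁻ s in Icc (0 : ℝ) 1, ENNReal.ofReal r *
        ‖mfderivWithin 𝓘(ℝ, ℝ) 𝓘(ℝ, E) c (Icc 0 1) s (1 : ℝ)‖ₑ := by
    refine MeasureTheory.setLIntegral_mono' measurableSet_Icc fun s hs => ?_
    have hu : UniqueDiffWithinAt ℝ (Icc (0 : ℝ) 1) s := uniqueDiffOn_Icc zero_lt_one s hs
    have h1 := mfderivWithin_extChartAt_comp (hc.mdifferentiableOn one_ne_zero s hs) hu
      (hsource s hs)
    have h2 : derivWithin (fun s => P (f s)) (Icc 0 1) s = P (derivWithin f (Icc 0 1) s) :=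
      (P.hasFDerivAt.comp_hasDerivWithinAt s
        ((hfd.differentiableOn one_ne_zero s hs).hasDerivWithinAt)).derivWithin hu
    have h3 := hP s hs (mfderivWithin 𝓘(ℝ, ℝ) 𝓘(ℝ, E) c (Icc 0 1) s (1 : ℝ))
    rw [h2, ← ofReal_norm, ← ofReal_norm, ← ENNReal.ofReal_mul hr.le]
    refine ENNReal.ofReal_le_ofReal ?_
    exact (congrArg (fun w : E => ‖P w‖) h1).symm.le.trans h3
  rw [MeasureTheory.lintegral_const_mul' _ _ ENNReal.ofReal_ne_top] at hbound
  have h4 : ‖P (f 1) - P (f 0)‖ₑ ≤ ENNReal.ofReal (r * L) := by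
    refine key.trans (hbound.trans ?_)
    rw [ENNReal.ofReal_mul hr.le]
    gcongr
    rw [pathELength_eq_lintegral_mfderivWithin_Icc] at hL
    exact hL.le
  rw [← map_sub, ← ofReal_norm, ENNReal.ofReal_le_ofReal_iff (by positivity)] at h4
  exact h4

variable [IsContMDiffRiemannianBundle 𝓘(ℝ, E) ∞ E (fun x : X => TangentSpace 𝓘(ℝ, E) x)]

variable (E) in
/-- Read in a chart around `x₀`, the Riemannian norm at nearby points is close to a fixed norm. -/
lemma exists_chart_norm_comparison (x₀ : X) {r : ℝ} (hr : 1 < r) :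
    ∃ P : E →L[ℝ] TangentSpace 𝓘(ℝ, E) x₀, ∀ᶠ y in 𝓝 x₀, ∀ v : TangentSpace 𝓘(ℝ, E) y,
      ‖P (mfderiv 𝓘(ℝ, E) 𝓘(ℝ, E) (extChartAt 𝓘(ℝ, E) x₀) y v)‖ ≤ r * ‖v‖ ∧
      ‖v‖ ≤ r * ‖P (mfderiv 𝓘(ℝ, E) 𝓘(ℝ, E) (extChartAt 𝓘(ℝ, E) x₀) y v)‖ := by
  have : IsContinuousRiemannianBundle E (fun x : X => TangentSpace 𝓘(ℝ, E) x) := by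
    obtain ⟨g, hg, hgi⟩ := IsContMDiffRiemannianBundle.exists_contMDiff (IB := 𝓘(ℝ, E)) (n := ∞)
      (F := E) (E := fun x : X => TangentSpace 𝓘(ℝ, E) x)
    exact ⟨g, hg.continuous, hgi⟩
  set e := trivializationAt E (fun x : X => TangentSpace 𝓘(ℝ, E) x) x₀ with he
  -- The fixed norm is the Riemannian norm at `x₀`, carried to the model space by the
  -- trivialization.
  refine ⟨e.symmL ℝ x₀, ?_⟩
  filter_upwards [eventually_norm_symmL_trivializationAt_self_comp_lt E
    (fun x : X => TangentSpace 𝓘(ℝ, E) x) x₀ hr,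
    eventually_norm_symmL_trivializationAt_comp_self_lt E
    (fun x : X => TangentSpace 𝓘(ℝ, E) x) x₀ hr, chart_source_mem_nhds E x₀] with y h1 h2 hy v
  have hT : mfderiv 𝓘(ℝ, E) 𝓘(ℝ, E) (extChartAt 𝓘(ℝ, E) x₀) y = e.continuousLinearMapAt ℝ y :=
    (TangentBundle.continuousLinearMapAt_trivializationAt hy).symm
  rw [hT]
  constructor
  · exact (ContinuousLinearMap.le_opNorm (e.symmL ℝ x₀ ∘L e.continuousLinearMapAt ℝ y) v).trans
      (mul_le_mul_of_nonneg_right h1.le (norm_nonneg v))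
  · have hyb : y ∈ e.baseSet := by simpa [he] using hy
    have hxb : x₀ ∈ e.baseSet := by simp [he]
    have hv : ((e.symmL ℝ y) ∘L (e.continuousLinearMapAt ℝ x₀))
        (e.symmL ℝ x₀ (e.continuousLinearMapAt ℝ y v)) = v := by
      simp only [ContinuousLinearMap.comp_apply]
      rw [e.continuousLinearMapAt_symmL hxb, e.symmL_continuousLinearMapAt hyb]
    exact (congrArg norm hv).symm.le.trans ((ContinuousLinearMap.le_opNorm _ _).trans
      (mul_le_mul_of_nonneg_right h2.le (norm_nonneg _)))

end Local

/-! ### Smooth curves of nearly minimal speed. -/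

/-- A smooth transition from `0` to `1` on `[0, 1]`, locally constant near the endpoints, whose
slope is at most a given constant larger than `1`. -/
lemma exists_smooth_plateau {κ : ℝ} (hκ : 1 < κ) :
    ∃ σ : ℝ → ℝ, ContDiff ℝ ∞ σ ∧ (∃ δ > 0, (∀ s < δ, σ s = 0) ∧ ∀ s > 1 - δ, σ s = 1) ∧
      (∀ s, σ s ∈ Icc (0 : ℝ) 1) ∧ ∀ s, |deriv σ s| ≤ κ := by
  -- The bump equals `1` on `[2δ, 1 - 2δ]`, of length `1 - 4δ = κ⁻¹`. Normalising its integral `J ≥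
  -- κ⁻¹` therefore multiplies the slope by at most `κ`.
  set δ : ℝ := (1 - κ⁻¹) / 4 with hδ
  have hκ0 : 0 < κ := by linarith
  have hκi : κ⁻¹ < 1 := inv_lt_one_of_one_lt₀ hκ
  have hκp : 0 < κ⁻¹ := by positivity
  have hδ0 : 0 < δ := by rw [hδ]; linarith
  have hδ1 : δ < 1 / 4 := by rw [hδ]; linarith
  let f : ContDiffBump (1 / 2 : ℝ) := ⟨1 / 2 - 2 * δ, 1 / 2 - δ, by linarith, by linarith⟩
  have hfc : Continuous f := f.continuous
  have hf0 : ∀ s, s ≤ δ → f s = 0 := fun s hs => f.zero_of_le_dist (by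
    rw [Real.dist_eq, abs_sub_comm]
    exact le_trans (by simp only [f]; linarith) (le_abs_self _))
  have hf1 : ∀ s, 1 - δ ≤ s → f s = 0 := fun s hs => f.zero_of_le_dist (by
    rw [Real.dist_eq]
    exact le_trans (by simp only [f]; linarith) (le_abs_self _))
  have hint : ∀ a b : ℝ, IntervalIntegrable f MeasureTheory.volume a b :=
    fun a b => hfc.intervalIntegrable a b
  set J : ℝ := ∫ s in (0 : ℝ)..1, f s with hJ
  have hJκ : κ⁻¹ ≤ J := by
    have h1 : ∫ s in (2 * δ)..(1 - 2 * δ), f s = κ⁻¹ := by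
      rw [intervalIntegral.integral_congr (g := fun _ => (1 : ℝ))]
      · rw [intervalIntegral.integral_const, smul_eq_mul, hδ]
        ring
      · intro s hs
        rw [uIcc_of_le (by linarith)] at hs
        refine f.one_of_mem_closedBall ?_
        rw [Metric.mem_closedBall, Real.dist_eq, abs_le]
        simp only [f]
        constructor <;> linarith [hs.1, hs.2]
    rw [← h1]
    exact intervalIntegral.integral_mono_interval (by linarith) (by linarith) (by linarith)
      (Eventually.of_forall fun s => f.nonneg) (hint _ _)
  have hJ0 : 0 < J := hκp.trans_le hJκ
  set σ : ℝ → ℝ := fun s => J⁻¹ * ∫ u in (0 : ℝ)..s, f u with hσ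
  have hder : ∀ s, HasDerivAt σ (J⁻¹ * f s) s := fun s =>
    (intervalIntegral.integral_hasDerivAt_right (hint 0 s)
      (hfc.stronglyMeasurableAtFilter _ _) hfc.continuousAt).const_mul J⁻¹
  have hderiv : deriv σ = fun s => J⁻¹ * f s := funext fun s => (hder s).deriv
  have hmono : Monotone σ := monotone_of_deriv_nonneg (fun s => (hder s).differentiableAt)
    fun s => by rw [hderiv]; exact mul_nonneg (inv_nonneg.2 hJ0.le) f.nonneg
  have hσ0 : ∀ s < δ, σ s = 0 := fun s hs => by
    have : ∫ u in (0 : ℝ)..s, f u = ∫ u in (0 : ℝ)..s, (0 : ℝ) :=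
      intervalIntegral.integral_congr fun u hu => hf0 u (by
        rcases mem_uIcc.1 hu with h | h <;> linarith [h.2])
    simp [hσ, this]
  have hσ1 : ∀ s > 1 - δ, σ s = 1 := fun s hs => by
    have h1 : ∫ u in (1 : ℝ)..s, f u = ∫ u in (1 : ℝ)..s, (0 : ℝ) :=
      intervalIntegral.integral_congr fun u hu => hf1 u (by
        rcases mem_uIcc.1 hu with h | h <;> linarith [h.1])
    simp only [hσ]
    rw [← intervalIntegral.integral_add_adjacent_intervals (hint 0 1) (hint 1 s), h1]
    simp only [intervalIntegral.integral_zero, add_zero]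
    exact inv_mul_cancel₀ hJ0.ne'
  refine ⟨σ, ?_, ⟨δ, hδ0, hσ0, hσ1⟩, fun s => ⟨?_, ?_⟩, fun s => ?_⟩
  · rw [contDiff_infty_iff_deriv]
    refine ⟨fun s => (hder s).differentiableAt, ?_⟩
    rw [hderiv]
    exact contDiff_const.mul f.contDiff
  · rw [← hσ0 (min s 0) ((min_le_right _ _).trans_lt hδ0)]
    exact hmono (min_le_left _ _)
  · rw [← hσ1 (max s 1) (lt_of_lt_of_le (by linarith) (le_max_right _ _))]
    exact hmono (le_max_left _ _)
  · rw [hderiv, abs_of_nonneg (mul_nonneg (inv_nonneg.2 hJ0.le) f.nonneg)]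
    calc J⁻¹ * f s ≤ κ * 1 := by
          refine mul_le_mul ?_ f.le_one f.nonneg hκ0.le
          exact inv_le_of_inv_le₀ hκ0 hJκ
      _ = κ := mul_one κ

section SmoothlyJoined

variable (E : Type*) [NormedAddCommGroup E] [NormedSpace ℝ E]
  {X : Type*} [MetricSpace X] [ChartedSpace E X]
  [RiemannianBundle (fun x : X => TangentSpace 𝓘(ℝ, E) x)]

/-- `x` and `y` are joined in time `T` by a smooth curve with speed at most `k` that is locally
constant near the endpoints. -/
def SmoothlyJoined (x y : X) (T k : ℝ) : Prop :=
  ∃ γ : ℝ → X, ContMDiff 𝓘(ℝ, ℝ) 𝓘(ℝ, E) ∞ γ ∧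
    (∃ δ > 0, (∀ s < δ, γ s = x) ∧ ∀ s > T - δ, γ s = y) ∧
    ∀ s, ‖mfderiv 𝓘(ℝ, ℝ) 𝓘(ℝ, E) γ s (1 : ℝ)‖ ≤ k

variable {E}

/-- Equal coordinate vectors at equal base points have the same Riemannian norm. -/
lemma norm_tangent_congr {x y : X} (h : x = y) {v : TangentSpace 𝓘(ℝ, E) x}
    {w : TangentSpace 𝓘(ℝ, E) y} (hvw : (v : E) = w) : ‖v‖ = ‖w‖ := by
  subst h
  exact congrArg norm hvw

lemma norm_mfderiv_congr {γ γ' : ℝ → X} {s : ℝ} (h : γ =ᶠ[𝓝 s] γ') :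
    ‖mfderiv 𝓘(ℝ, ℝ) 𝓘(ℝ, E) γ s (1 : ℝ)‖ = ‖mfderiv 𝓘(ℝ, ℝ) 𝓘(ℝ, E) γ' s (1 : ℝ)‖ := by
  exact norm_tangent_congr h.self_of_nhds
    (congrArg (fun L : ℝ →L[ℝ] E => L 1) (h.mfderiv_eq (I := 𝓘(ℝ, ℝ)) (I' := 𝓘(ℝ, E))))

lemma norm_mfderiv_comp_real {γ : ℝ → X} {σ : ℝ → ℝ} {s : ℝ}
    (hγ : MDifferentiableAt 𝓘(ℝ, ℝ) 𝓘(ℝ, E) γ (σ s)) (hσ : DifferentiableAt ℝ σ s) :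
    ‖mfderiv 𝓘(ℝ, ℝ) 𝓘(ℝ, E) (fun u => γ (σ u)) s (1 : ℝ)‖ =
      |deriv σ s| * ‖mfderiv 𝓘(ℝ, ℝ) 𝓘(ℝ, E) γ (σ s) (1 : ℝ)‖ := by
  have h : mfderiv 𝓘(ℝ, ℝ) 𝓘(ℝ, E) (γ ∘ σ) s =
      (mfderiv 𝓘(ℝ, ℝ) 𝓘(ℝ, E) γ (σ s)) ∘L (mfderiv 𝓘(ℝ, ℝ) 𝓘(ℝ, ℝ) σ s) :=
    mfderiv_comp s hγ hσ.mdifferentiableAt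
  have h1 : mfderiv 𝓘(ℝ, ℝ) 𝓘(ℝ, E) (γ ∘ σ) s (1 : ℝ) =
      deriv σ s • mfderiv 𝓘(ℝ, ℝ) 𝓘(ℝ, E) γ (σ s) (1 : ℝ) := by
    rw [h]
    have h2 : mfderiv 𝓘(ℝ, ℝ) 𝓘(ℝ, ℝ) σ s (1 : ℝ) = deriv σ s • (1 : ℝ) := by
      rw [mfderiv_eq_fderiv, smul_eq_mul, mul_one]
      exact fderiv_apply_one_eq_deriv
    exact (congrArg (mfderiv 𝓘(ℝ, ℝ) 𝓘(ℝ, E) γ (σ s)) h2).trans (map_smul _ _ _)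
  exact (congrArg norm h1).trans ((norm_smul _ _).trans (by rw [Real.norm_eq_abs]))

/-- Both curves are constantly `y` near the junction, so they agree on a neighbourhood of it and the
glued curve is smooth with the same speed bound. -/
lemma SmoothlyJoined.trans {x y z : X} {T₁ T₂ k : ℝ} (hT₁ : 0 ≤ T₁) (hT₂ : 0 ≤ T₂)
    (h₁ : SmoothlyJoined E x y T₁ k) (h₂ : SmoothlyJoined E y z T₂ k) :
    SmoothlyJoined E x z (T₁ + T₂) k := by
  obtain ⟨γ₁, hγ₁, ⟨δ₁, hδ₁, h10, h11⟩, hk₁⟩ := h₁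
  obtain ⟨γ₂, hγ₂, ⟨δ₂, hδ₂, h20, h21⟩, hk₂⟩ := h₂
  have hshift : ContMDiff 𝓘(ℝ, ℝ) 𝓘(ℝ, E) ∞ (fun s => γ₂ (s - T₁)) :=
    hγ₂.comp (contDiff_id.sub contDiff_const).contMDiff
  have hmid : γ₁ =ᶠ[𝓝 T₁] fun s => γ₂ (s - T₁) := by
    filter_upwards [Ioo_mem_nhds (show T₁ - δ₁ < T₁ by linarith) (show T₁ < T₁ + δ₂ by linarith)]
      with s hs
    rw [h11 s hs.1, h20 (s - T₁) (by linarith [hs.2])]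
  have hval₁ : ∀ s ≤ T₁, (Iic T₁).piecewise γ₁ (fun s => γ₂ (s - T₁)) s = γ₁ s :=
    fun s hs => piecewise_eq_of_mem _ _ _ hs
  have hval₂ : ∀ s, T₁ < s → (Iic T₁).piecewise γ₁ (fun s => γ₂ (s - T₁)) s = γ₂ (s - T₁) :=
    fun s hs => piecewise_eq_of_notMem _ _ _ (by simpa using hs)
  refine ⟨(Iic T₁).piecewise γ₁ (fun s => γ₂ (s - T₁)), hγ₁.piecewise_Iic hshift hmid,
    ⟨min δ₁ δ₂, lt_min hδ₁ hδ₂, fun s hs => ?_, fun s hs => ?_⟩, fun s => ?_⟩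
  · obtain ⟨hs1, hs2⟩ := lt_min_iff.1 hs
    rcases le_or_gt s T₁ with h | h
    · rw [hval₁ s h, h10 s hs1]
    · rw [hval₂ s h, h20 _ (by linarith), ← h11 s (by linarith), h10 s hs1]
  · have hd1 := min_le_left δ₁ δ₂
    have hd2 := min_le_right δ₁ δ₂
    rcases le_or_gt s T₁ with h | h
    · rw [hval₁ s h, h11 s (by linarith), ← h20 (s - T₁) (by linarith), h21 _ (by linarith)]
    · rw [hval₂ s h, h21 _ (by linarith)]
  · rcases lt_or_ge T₁ s with h | h
    · have : (Iic T₁).piecewise γ₁ (fun s => γ₂ (s - T₁)) =ᶠ[𝓝 s] fun s => γ₂ (s - T₁) := by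
        filter_upwards [Ioi_mem_nhds h] with u hu using hval₂ u hu
      rw [norm_mfderiv_congr this, norm_mfderiv_comp_real (hγ₂.mdifferentiable (by simp) _)
        (by fun_prop)]
      simpa using hk₂ (s - T₁)
    · have : (Iic T₁).piecewise γ₁ (fun s => γ₂ (s - T₁)) =ᶠ[𝓝 s] γ₁ := by
        rcases h.eq_or_lt with rfl | h
        · filter_upwards [hmid] with u hu
          rcases le_or_gt u s with h' | h'
          · exact hval₁ u h'
          · rw [hval₂ u h', hu]
        · filter_upwards [Iio_mem_nhds h] with u hu using hval₁ u (le_of_lt hu)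
      rw [norm_mfderiv_congr this]
      exact hk₁ s

end SmoothlyJoined

section NearlyMinimalCurves

variable (E : Type*) [NormedAddCommGroup E] [NormedSpace ℝ E]
  {X : Type*} [MetricSpace X] [ChartedSpace E X] [IsManifold 𝓘(ℝ, E) ∞ X]
  [RiemannianBundle (fun x : X => TangentSpace 𝓘(ℝ, E) x)]
  [IsContMDiffRiemannianBundle 𝓘(ℝ, E) ∞ E (fun x : X => TangentSpace 𝓘(ℝ, E) x)]
  [IsRiemannianManifold 𝓘(ℝ, E) X]

/-- The curve is a chart segment run through a plateau function in time `T`. The three factors `κ`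
come from the slope of the plateau, from bounding the chart norm by the distance, and from returning
to the Riemannian norm. -/
lemma exists_ball_smoothlyJoined (x₀ : X) {κ : ℝ} (hκ : 1 < κ) :
    ∃ ρ > 0, ∀ x ∈ Metric.ball x₀ ρ, ∀ y ∈ Metric.ball x₀ ρ, ∀ T k : ℝ, 0 < T →
      κ ^ 3 * dist x y ≤ k * T → SmoothlyJoined E x y T k := by
  have hκ0 : 0 < κ := by linarith
  obtain ⟨P, hP⟩ := exists_chart_norm_comparison E x₀ hκ
  set φ := extChartAt 𝓘(ℝ, E) x₀ with hφ
  set G : Set X := {y | ∀ v : TangentSpace 𝓘(ℝ, E) y,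
      ‖P (mfderiv 𝓘(ℝ, E) 𝓘(ℝ, E) φ y v)‖ ≤ κ * ‖v‖ ∧
      ‖v‖ ≤ κ * ‖P (mfderiv 𝓘(ℝ, E) 𝓘(ℝ, E) φ y v)‖} with hG
  have hGmem : G ∈ 𝓝 x₀ := hP
  have hG' : G ∩ (chartAt E x₀).source ∈ 𝓝 x₀ := inter_mem hGmem (chart_source_mem_nhds E x₀)
  -- A ball in coordinates is convex, so segments in it stay where the norm comparison holds.
  obtain ⟨ε, hε, hball⟩ := Metric.mem_nhds_iff.1 (inter_mem
    (extChartAt_target_mem_nhds (I := 𝓘(ℝ, E)) x₀)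
    (extChartAt_preimage_mem_nhds (I := 𝓘(ℝ, E)) hG'))
  obtain ⟨ρ', hρ', hball'⟩ := Metric.mem_nhds_iff.1 (inter_mem hG'
    ((continuousAt_extChartAt (I := 𝓘(ℝ, E)) x₀).preimage_mem_nhds (Metric.ball_mem_nhds _ hε)))
  -- A path starting within `ρ' / 3` of `x₀` and of length below `2 * ρ' / 3` remains in the ball of
  -- radius `ρ'`.
  refine ⟨ρ' / 3, by positivity, fun x hx y hy T k hT hk => ?_⟩
  have hx' := Metric.mem_ball.1 hx
  have hy' := Metric.mem_ball.1 hy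
  have hxy : dist x y < 2 * ρ' / 3 := by
    have := dist_triangle_right x y x₀
    linarith
  have hxb := hball' (Metric.ball_subset_ball (by linarith) hx)
  have hyb := hball' (Metric.ball_subset_ball (by linarith) hy)
  have hlower : ‖P (φ y - φ x)‖ ≤ κ * dist x y := by
    have hL : ∀ L, dist x y < L → L < 2 * ρ' / 3 → ‖P (φ y - φ x)‖ ≤ κ * L := by
      intro L hL hL'
      obtain ⟨c, hc0, hc1, hc, hcL⟩ := exists_path_of_dist_lt E hL
      have hmem : ∀ s ∈ Icc (0 : ℝ) 1, c s ∈ G ∩ (chartAt E x₀).source := by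
        intro s hs
        refine (hball' ?_).1
        have h1 := edist_le_pathELength E (hc.mono (Icc_subset_Icc_right hs.2)) hs.1
        have h2 := (h1.trans (pathELength_mono le_rfl hs.2)).trans_lt hcL
        rw [hc0, edist_dist, ENNReal.ofReal_lt_ofReal_iff (dist_nonneg.trans_lt hL)] at h2
        rw [Metric.mem_ball]
        have := dist_triangle (c s) x x₀
        rw [dist_comm (c s) x] at this
        linarith
      have := norm_chart_sub_le_of_pathELength_lt E hκ0 P hc (fun s hs => (hmem s hs).2)
        (fun s hs v => ((hmem s hs).1 v).1) hcL
      rwa [hc0, hc1] at this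
    have hlim : Tendsto (fun L => κ * L) (𝓝[>] dist x y) (𝓝 (κ * dist x y)) :=
      ((continuous_const.mul continuous_id).tendsto _).mono_left nhdsWithin_le_nhds
    refine ge_of_tendsto hlim ?_
    filter_upwards [self_mem_nhdsWithin, nhdsWithin_le_nhds (Iio_mem_nhds hxy)] with L h1 h2
    exact hL L h1 h2
  obtain ⟨σ, hσ, ⟨δ, hδ, hσ0, hσ1⟩, hσI, hσd⟩ := exists_smooth_plateau hκ
  set τ : ℝ → ℝ := fun s => σ (T⁻¹ * s) with hτ
  have hτs : ContDiff ℝ ∞ τ := hσ.comp (contDiff_const.mul contDiff_id)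
  have hτd : ∀ s, |deriv τ s| ≤ κ * T⁻¹ := by
    intro s
    have h := ((hσ.differentiable (by simp) (T⁻¹ * s)).hasDerivAt).comp s
      ((hasDerivAt_id s).const_mul T⁻¹)
    have h' : deriv τ s = deriv σ (T⁻¹ * s) * (T⁻¹ * 1) := h.deriv
    rw [h', abs_mul, mul_one, abs_of_pos (inv_pos.2 hT)]
    exact mul_le_mul_of_nonneg_right (hσd _) (inv_pos.2 hT).le
  set ℓ : ℝ → E := fun s => φ x + τ s • (φ y - φ x) with hℓ
  have hℓs : ContDiff ℝ ∞ ℓ := contDiff_const.add (hτs.smul contDiff_const)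
  have hℓmem : ∀ s, ℓ s ∈ φ.target ∩ φ.symm ⁻¹' (G ∩ (chartAt E x₀).source) := fun s =>
    hball ((convex_ball _ _).add_smul_sub_mem hxb.2 hyb.2 (hσI _))
  set γ : ℝ → X := fun s => φ.symm (ℓ s) with hγ
  have hγs : ContMDiff 𝓘(ℝ, ℝ) 𝓘(ℝ, E) ∞ γ := by
    rw [← contMDiffOn_univ]
    exact (contMDiffOn_extChartAt_symm x₀).comp hℓs.contMDiff.contMDiffOn
      (fun s _ => (hℓmem s).1)
  refine ⟨γ, hγs, ⟨T * δ, by positivity, fun s hs => ?_, fun s hs => ?_⟩, fun s => ?_⟩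
  · have : τ s = 0 := hσ0 _ (by rwa [inv_mul_lt_iff₀ hT])
    simp only [hγ, hℓ, this, zero_smul, add_zero]
    exact φ.left_inv (by simpa [hφ] using hxb.1.2)
  · have : τ s = 1 := hσ1 _ (by
      rw [gt_iff_lt, lt_inv_mul_iff₀ hT]
      linarith)
    simp only [hγ, hℓ, this, one_smul, add_sub_cancel]
    exact φ.left_inv (by simpa [hφ] using hyb.1.2)
  · have hmem : γ s ∈ G ∩ (chartAt E x₀).source := (hℓmem s).2
    have hder := mfderivWithin_extChartAt_comp (x₀ := x₀) (γ := γ) (t := univ) (s := s)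
      (hγs.mdifferentiable (by simp) s).mdifferentiableWithinAt uniqueDiffWithinAt_univ hmem.2
    have hφγ : (fun u => φ (γ u)) = ℓ := funext fun u => φ.right_inv (hℓmem u).1
    rw [mfderivWithin_univ, derivWithin_univ, ← hφ, hφγ] at hder
    have hℓd : deriv ℓ s = deriv τ s • (φ y - φ x) :=
      (((hτs.differentiable (by simp) s).hasDerivAt.smul_const _).const_add _).deriv
    have h1 := (hmem.1 (mfderiv 𝓘(ℝ, ℝ) 𝓘(ℝ, E) γ s (1 : ℝ))).2
    have h2 := congrArg (fun w : E => κ * ‖P w‖) (hder.trans hℓd)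
    refine h1.trans (h2.le.trans ?_)
    simp only [map_smul, norm_smul, Real.norm_eq_abs]
    calc κ * (|deriv τ s| * ‖P (φ y - φ x)‖) ≤ κ * (κ * T⁻¹ * (κ * dist x y)) := by
          gcongr
          exact hτd s
      _ = κ ^ 3 * dist x y * T⁻¹ := by ring
      _ ≤ k * T * T⁻¹ := mul_le_mul_of_nonneg_right hk (inv_pos.2 hT).le
      _ = k := mul_inv_cancel_right₀ hT.ne' k

/-- Cut a budget `D` between `dist v u` and `k` into `N` steps of length `D / N` and duration `1 /
N`. A Lebesgue number of the compact ball of radius `D` makes every step local, and `κ ^ 3 * D < k`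
leaves room for the loss in each chart. -/
lemma smoothlyJoined_of_dist_lt [ProperSpace X] {v u : X} {k : ℝ} (h : dist v u < k) :
    SmoothlyJoined E v u 1 k := by
  obtain ⟨D, hD, hDk⟩ := exists_between h
  have hD0 : 0 < D := dist_nonneg.trans_lt hD
  obtain ⟨κ, hκ, hκD⟩ : ∃ κ : ℝ, 1 < κ ∧ κ ^ 3 * D < k := by
    have hlim : Tendsto (fun κ : ℝ => κ ^ 3 * D) (𝓝[>] 1) (𝓝 (1 ^ 3 * D)) :=
      (((continuous_id.pow 3).mul continuous_const).tendsto _).mono_left nhdsWithin_le_nhds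
    obtain ⟨κ, h1, h2⟩ := ((hlim.eventually (Iio_mem_nhds (show 1 ^ 3 * D < k by linarith))).and
      self_mem_nhdsWithin).exists
    exact ⟨κ, h2, h1⟩
  choose ρ hρ hjoin using fun x₀ : X => exists_ball_smoothlyJoined E x₀ hκ
  obtain ⟨δ, hδ, hleb⟩ := lebesgue_number_lemma_of_metric (isCompact_closedBall v D)
    (c := fun x₀ : X => Metric.ball x₀ (ρ x₀)) (fun _ => Metric.isOpen_ball)
    (fun x _ => mem_iUnion.2 ⟨x, Metric.mem_ball_self (hρ x)⟩)
  obtain ⟨N, hN⟩ := exists_nat_gt (D / δ)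
  have hN0 : (0 : ℝ) < N := (by positivity : 0 < D / δ).trans hN
  have ha : D / N < δ := by rwa [div_lt_comm₀ hN0 hδ]
  have ha0 : 0 < D / N := by positivity
  have hT : (0 : ℝ) < 1 / N := by positivity
  have hstep : ∀ x z : X, dist v x ≤ D → dist x z ≤ D / N → SmoothlyJoined E x z (1 / N) k := by
    intro x z hx hz
    obtain ⟨x₀, hx₀⟩ := hleb x (Metric.mem_closedBall'.2 hx)
    refine hjoin x₀ x (hx₀ (Metric.mem_ball_self hδ)) z
      (hx₀ (Metric.mem_ball'.2 (hz.trans_lt ha))) _ _ hT ?_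
    calc κ ^ 3 * dist x z ≤ κ ^ 3 * (D / N) := by gcongr
      _ = κ ^ 3 * D * (1 / N) := by ring
      _ ≤ k * (1 / N) := by gcongr
  -- With `n + 1` steps left, the first hypothesis keeps later points in the ball of radius `D`, and
  -- the second says that the remaining budget reaches `u`.
  have hchain : ∀ n : ℕ, ∀ x : X, dist v x + (n + 1) * (D / N) ≤ D →
      dist x u < (n + 1) * (D / N) → SmoothlyJoined E x u ((n + 1) * (1 / N)) k := by
    intro n
    induction n with
    | zero =>
      intro x hx hxu
      simp only [CharP.cast_eq_zero, zero_add, one_mul] at hx hxu ⊢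
      exact hstep x u (by linarith) hxu.le
    | succ n ih =>
      intro x hx hxu
      push_cast at hx hxu ⊢
      have hn : 0 < ((n : ℝ) + 1) * (D / N) := by positivity
      obtain ⟨z, hxz, hzu⟩ := hasApproxSplitting E X x u (D / N) ((n + 1) * (D / N)) ha0.le hn
        (by linarith)
      have h1 := hstep x z (by linarith) hxz
      have h2 := ih z (by linarith [dist_triangle v x z]) hzu
      have := h1.trans hT.le (by positivity) h2
      convert this using 1
      ring
  obtain ⟨n, rfl⟩ : ∃ n : ℕ, N = n + 1 := ⟨N - 1, by
    have : 0 < N := by exact_mod_cast hN0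
    omega⟩
  have hn : ((n : ℝ) + 1) * (D / ((n + 1 : ℕ) : ℝ)) = D := by
    push_cast
    field_simp
  have := hchain n v (by rw [hn]; simp) (by rw [hn]; exact hD)
  convert this using 1
  push_cast
  field_simp

end NearlyMinimalCurves

/-! ### Joint smoothness of the deformation and of the action. -/

section Smoothness

variable {E : Type*} [NormedAddCommGroup E] [NormedSpace ℝ E]
  {X : Type*} [TopologicalSpace X] [ChartedSpace E X] {S : ℝ → X → X} {γ : ℝ → X}

/-- The domain `[0, ∞) × [0, 1]` of the deformation of a curve. -/
abbrev deformDomain : Set (ℝ × ℝ) := Ici 0 ×ˢ Icc 0 1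

lemma uniqueDiffOn_deformDomain : UniqueDiffOn ℝ deformDomain :=
  (uniqueDiffOn_Ici 0).prod (uniqueDiffOn_Icc zero_lt_one)

lemma contMDiffOn_deform (hS : IsSmoothSemigroup E S)
    (hγ : ContMDiffOn 𝓘(ℝ, ℝ) 𝓘(ℝ, E) ∞ γ (Icc 0 1)) :
    ContMDiffOn 𝓘(ℝ, ℝ × ℝ) 𝓘(ℝ, E) ∞ (fun p : ℝ × ℝ => deform S γ p.1 p.2) deformDomain := by
  have h1 : ContMDiffOn 𝓘(ℝ, ℝ × ℝ) (𝓘(ℝ, ℝ).prod 𝓘(ℝ, E)) ∞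
      (fun p : ℝ × ℝ => (p.2 * p.1, γ p.2)) deformDomain :=
    ((contDiff_snd.mul contDiff_fst).contMDiff.contMDiffOn).prodMk
      (hγ.comp contDiff_snd.contMDiff.contMDiffOn fun p hp => hp.2)
  exact hS.smooth.comp h1 fun p hp => ⟨mul_nonneg hp.2.1 hp.1, mem_univ _⟩

lemma contMDiffOn_deform_right (hS : IsSmoothSemigroup E S)
    (hγ : ContMDiffOn 𝓘(ℝ, ℝ) 𝓘(ℝ, E) ∞ γ (Icc 0 1)) {t : ℝ} (ht : 0 ≤ t) :
    ContMDiffOn 𝓘(ℝ, ℝ) 𝓘(ℝ, E) ∞ (deform S γ t) (Icc 0 1) :=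
  (contMDiffOn_deform hS hγ).comp (f := fun s : ℝ => ((t, s) : ℝ × ℝ))
    (contDiff_const.prodMk contDiff_id).contMDiff.contMDiffOn fun _ hs => ⟨ht, hs⟩

/-- The velocity in `s` becomes a joint derivative in a fixed direction, whose smoothness in `(t,
s)` comes from the tangent map. -/
lemma mfderivWithin_deform_eq (hS : IsSmoothSemigroup E S)
    (hγ : ContMDiffOn 𝓘(ℝ, ℝ) 𝓘(ℝ, E) ∞ γ (Icc 0 1)) {t s : ℝ} (ht : 0 ≤ t)
    (hs : s ∈ Icc (0 : ℝ) 1) :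
    mfderivWithin 𝓘(ℝ, ℝ) 𝓘(ℝ, E) (deform S γ t) (Icc 0 1) s (1 : ℝ) =
      mfderivWithin 𝓘(ℝ, ℝ × ℝ) 𝓘(ℝ, E) (fun p : ℝ × ℝ => deform S γ p.1 p.2) deformDomain
        (t, s) ((0, 1) : ℝ × ℝ) := by
  have hu : UniqueDiffWithinAt ℝ (Icc (0 : ℝ) 1) s := uniqueDiffOn_Icc zero_lt_one s hs
  have hj : HasDerivWithinAt (fun σ : ℝ => ((t, σ) : ℝ × ℝ)) (0, 1) (Icc 0 1) s :=
    (hasDerivWithinAt_const s _ t).prodMk (hasDerivWithinAt_id s _)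
  have h := mfderivWithin_comp (I := 𝓘(ℝ, ℝ)) (I' := 𝓘(ℝ, ℝ × ℝ)) (I'' := 𝓘(ℝ, E)) s
    (g := fun p : ℝ × ℝ => deform S γ p.1 p.2) (f := fun σ : ℝ => ((t, σ) : ℝ × ℝ))
    (u := deformDomain) (s := Icc (0 : ℝ) 1)
    ((contMDiffOn_deform hS hγ).mdifferentiableOn (by simp) (t, s) ⟨ht, hs⟩)
    hj.differentiableWithinAt.mdifferentiableWithinAt
    (fun σ hσ => ⟨ht, hσ⟩) (uniqueMDiffWithinAt_iff_uniqueDiffWithinAt.2 hu)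
  have h2 : mfderivWithin 𝓘(ℝ, ℝ) 𝓘(ℝ, ℝ × ℝ) (fun σ : ℝ => ((t, σ) : ℝ × ℝ)) (Icc 0 1) s (1 : ℝ)
      = ((0, 1) : ℝ × ℝ) := by
    have : fderivWithin ℝ (fun σ : ℝ => ((t, σ) : ℝ × ℝ)) (Icc 0 1) s 1 = (0, 1) :=
      fderivWithin_derivWithin.trans (hj.derivWithin hu)
    rw [mfderivWithin_eq_fderivWithin]
    exact this
  have h3 := congrArg (fun L : ℝ →L[ℝ] E => L 1) h
  exact h3.trans (congrArg (mfderivWithin 𝓘(ℝ, ℝ × ℝ) 𝓘(ℝ, E)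
    (fun p : ℝ × ℝ => deform S γ p.1 p.2) deformDomain (t, s)) h2)

lemma contDiffOn_comp_deform (hS : IsSmoothSemigroup E S) {F : X → ℝ}
    (hF : ContMDiff 𝓘(ℝ, E) 𝓘(ℝ, ℝ) ∞ F) (hγ : ContMDiffOn 𝓘(ℝ, ℝ) 𝓘(ℝ, E) ∞ γ (Icc 0 1)) :
    ContDiffOn ℝ ∞ (fun p : ℝ × ℝ => F (deform S γ p.1 p.2)) deformDomain := by
  rw [← contMDiffOn_iff_contDiffOn]
  exact hF.comp_contMDiffOn (contMDiffOn_deform hS hγ)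

lemma contDiffOn_comp_trajectory (hS : IsSmoothSemigroup E S) {F : X → ℝ}
    (hF : ContMDiff 𝓘(ℝ, E) 𝓘(ℝ, ℝ) ∞ F) (u : X) :
    ContDiffOn ℝ ∞ (fun t => F (S t u)) (Ici 0) := by
  rw [← contMDiffOn_iff_contDiffOn]
  exact hF.comp_contMDiffOn (hS.smooth.comp (f := fun t : ℝ => ((t, u) : ℝ × X))
      (contMDiff_id.prodMk contMDiff_const).contMDiffOn fun t ht => ⟨ht, mem_univ _⟩)

variable [IsManifold 𝓘(ℝ, E) ∞ X] [RiemannianBundle (fun x : X => TangentSpace 𝓘(ℝ, E) x)]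
  [IsContMDiffRiemannianBundle 𝓘(ℝ, E) ∞ E (fun x : X => TangentSpace 𝓘(ℝ, E) x)]

lemma contDiffOn_action (hS : IsSmoothSemigroup E S)
    (hγ : ContMDiffOn 𝓘(ℝ, ℝ) 𝓘(ℝ, E) ∞ γ (Icc 0 1)) :
    ContDiffOn ℝ ∞ (fun p : ℝ × ℝ => action E S γ p.1 p.2) deformDomain := by
  rw [← contMDiffOn_iff_contDiffOn]
  set G : ℝ × ℝ → X := fun p => deform S γ p.1 p.2 with hG
  have h1 : ContMDiffOn 𝓘(ℝ, ℝ × ℝ) 𝓘(ℝ, ℝ × ℝ).tangent ∞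
      (fun p : ℝ × ℝ => (⟨p, ((0, 1) : ℝ × ℝ)⟩ : TangentBundle 𝓘(ℝ, ℝ × ℝ) (ℝ × ℝ)))
      deformDomain := by
    apply ContMDiff.contMDiffOn
    exact contMDiff_vectorSpace_iff_contDiff.2 contDiff_const
  have h2 := ((contMDiffOn_deform hS hγ).contMDiffOn_tangentMapWithin (m := ∞) (by simp)
    uniqueDiffOn_deformDomain.uniqueMDiffOn).comp h1 (fun p hp => hp)
  have h3 : ContMDiffOn 𝓘(ℝ, ℝ × ℝ) (𝓘(ℝ, E).prod 𝓘(ℝ, E)) ∞ (fun p : ℝ × ℝ =>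
      (⟨G p, mfderivWithin 𝓘(ℝ, ℝ × ℝ) 𝓘(ℝ, E) G deformDomain p ((0, 1) : ℝ × ℝ)⟩ :
        TotalSpace E (fun x : X => TangentSpace 𝓘(ℝ, E) x))) deformDomain := h2
  have h4 := ContMDiffOn.inner_bundle (E := fun x : X => TangentSpace 𝓘(ℝ, E) x) (b := G)
    (v := fun p => mfderivWithin 𝓘(ℝ, ℝ × ℝ) 𝓘(ℝ, E) G deformDomain p ((0, 1) : ℝ × ℝ))
    (w := fun p => mfderivWithin 𝓘(ℝ, ℝ × ℝ) 𝓘(ℝ, E) G deformDomain p ((0, 1) : ℝ × ℝ)) h3 h3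
  refine h4.congr fun p hp => ?_
  rw [action, real_inner_self_eq_norm_sq]
  congr 1
  exact congrArg norm (mfderivWithin_deform_eq hS hγ hp.1 hp.2)

end Smoothness

/-! ### Time shifts and the reduction to time zero. -/

section Shift

variable {E : Type*} [NormedAddCommGroup E] [NormedSpace ℝ E]
  {X : Type*} [MetricSpace X] [ChartedSpace E X] {S : ℝ → X → X} {γ : ℝ → X}

lemma deform_deform (hS : IsSmoothSemigroup E S) {t h s : ℝ} (ht : 0 ≤ t) (hh : 0 ≤ h)
    (hs : s ∈ Icc (0 : ℝ) 1) : deform S (deform S γ t) h s = deform S γ (t + h) s := by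
  simp only [deform]
  rw [mul_add, hS.add _ _ (mul_nonneg hs.1 ht) (mul_nonneg hs.1 hh)]

lemma deform_zero (hS : IsSmoothSemigroup E S) (s : ℝ) : deform S γ 0 s = γ s := by
  simp only [deform, mul_zero, hS.zero]

variable [RiemannianBundle (fun x : X => TangentSpace 𝓘(ℝ, E) x)]

lemma action_deform (hS : IsSmoothSemigroup E S) {t h s : ℝ} (ht : 0 ≤ t) (hh : 0 ≤ h)
    (hs : s ∈ Icc (0 : ℝ) 1) : action E S (deform S γ t) h s = action E S γ (t + h) s := by
  rw [action, action]
  congr 1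
  refine norm_tangent_congr (deform_deform hS ht hh hs) ?_
  exact congrArg (fun L : ℝ →L[ℝ] E => L 1) (mfderivWithin_congr (I := 𝓘(ℝ, ℝ)) (I' := 𝓘(ℝ, E))
    (fun σ hσ => deform_deform hS ht hh hσ) (deform_deform hS ht hh hs))

lemma action_zero_le (hS : IsSmoothSemigroup E S) (hγ : ContMDiff 𝓘(ℝ, ℝ) 𝓘(ℝ, E) ∞ γ) {k : ℝ}
    (hk : ∀ s, ‖mfderiv 𝓘(ℝ, ℝ) 𝓘(ℝ, E) γ s (1 : ℝ)‖ ≤ k) {s : ℝ} (hs : s ∈ Icc (0 : ℝ) 1) :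
    action E S γ 0 s ≤ k ^ 2 := by
  have h0 : deform S γ 0 = γ := funext fun s => deform_zero hS s
  rw [action, h0, MDifferentiable.mfderivWithin (hγ.mdifferentiable (by simp) s)
    (uniqueDiffOn_Icc zero_lt_one s hs).uniqueMDiffWithinAt]
  exact pow_le_pow_left₀ (norm_nonneg _) (hk s) 2

variable [IsManifold 𝓘(ℝ, E) ∞ X]
  [IsContMDiffRiemannianBundle 𝓘(ℝ, E) ∞ E (fun x : X => TangentSpace 𝓘(ℝ, E) x)]

lemma differentiableWithinAt_action (hS : IsSmoothSemigroup E S)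
    (hγ : ContMDiffOn 𝓘(ℝ, ℝ) 𝓘(ℝ, E) ∞ γ (Icc 0 1)) {t s : ℝ} (ht : 0 ≤ t)
    (hs : s ∈ Icc (0 : ℝ) 1) :
    DifferentiableWithinAt ℝ (fun r => action E S γ r s) (Ici 0) t :=
  ((contDiffOn_action hS hγ).differentiableOn (by simp) (t, s) ⟨ht, hs⟩).comp t
    (f := fun r : ℝ => ((r, s) : ℝ × ℝ)) (by fun_prop) (fun r hr => ⟨hr, hs⟩)

/-- It suffices to check the action inequality at time zero. -/
lemma actionInequalityAt_of_zero (hS : IsSmoothSemigroup E S) {F : X → ℝ} {lam : ℝ}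
    (h : ActionInequalityAt E F lam S 0) {t : ℝ} (ht : 0 ≤ t) :
    ActionInequalityAt E F lam S t := by
  intro γ hγ s hs
  -- The deformed curve is itself an admissible curve, and its action at time `r` is that of `γ` at
  -- time `t + r`.
  have key := h (deform S γ t) (contMDiffOn_deform_right hS hγ ht) s hs
  have h1 : derivWithin (fun r => action E S (deform S γ t) r s) (Ici 0) 0 =
      derivWithin (fun r => action E S γ r s) (Ici 0) t := by
    have hd := (differentiableWithinAt_action hS hγ ht hs).hasDerivWithinAt
    have hd' : HasDerivWithinAt (fun r => action E S γ (t + r) s)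
        (derivWithin (fun r => action E S γ r s) (Ici 0) t) (Ici 0) 0 := by
      have hd0 : HasDerivWithinAt (fun r => action E S γ r s)
        (derivWithin (fun r => action E S γ r s) (Ici 0) t) (Ici 0) (t + 0) := by simpa using hd
      have := hd0.comp (0 : ℝ) ((hasDerivWithinAt_id (0 : ℝ) (Ici 0)).const_add t)
        (fun r hr => add_nonneg ht hr)
      rw [mul_one] at this
      exact this
    refine (hd'.congr (fun r hr => action_deform hS ht hr hs)
      (action_deform hS ht le_rfl hs)).derivWithin (uniqueDiffOn_Ici 0 0 self_mem_Ici)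
  have h2 : (fun σ => F (deform S (deform S γ t) 0 σ)) = fun σ => F (deform S γ t σ) :=
    funext fun σ => by rw [deform_zero hS]
  rw [h1, h2, action_deform hS ht le_rfl hs, add_zero] at key
  exact key

end Shift

/-! ### The generator of the semigroup. -/

section Gradient

variable {E : Type*} [NormedAddCommGroup E] [NormedSpace ℝ E]
  {X : Type*} [MetricSpace X] [ChartedSpace E X] {S : ℝ → X → X} {γ : ℝ → X}

/-- With the derivative typed on the model spaces, passing between base points such as `t + 0` and
`t` needs no cast. -/
lemma hasMFDerivWithinAt_of_eq {E' : Type*} [NormedAddCommGroup E'] [NormedSpace ℝ E']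
    {H' : Type*} [TopologicalSpace H'] {I' : ModelWithCorners ℝ E' H'}
    {Y : Type*} [TopologicalSpace Y] [ChartedSpace H' Y] {f : Y → X} {s : Set Y}
    {x y : Y} (h : x = y) {L : E' →L[ℝ] E} (hL : HasMFDerivWithinAt I' 𝓘(ℝ, E) f s x L) :
    HasMFDerivWithinAt I' 𝓘(ℝ, E) f s y L := by
  subst h
  exact hL

variable (E) in
/-- The velocity at time zero of the trajectory of a semigroup starting at `x`. -/
def generator (S : ℝ → X → X) (x : X) : E :=
  mfderivWithin 𝓘(ℝ, ℝ) 𝓘(ℝ, E) (fun t => S t x) (Ici 0) 0 (1 : ℝ)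

/-- By linearity two directions suffice: `S 0 = id` gives the `w` part, and the trajectory through
`x` gives the `t` part. -/
lemma exists_derivative_flow (hS : IsSmoothSemigroup E S) (x : X) :
    ∃ L : ℝ × E →L[ℝ] E,
      HasMFDerivWithinAt (𝓘(ℝ, ℝ).prod 𝓘(ℝ, E)) 𝓘(ℝ, E) (fun p : ℝ × X => S p.1 p.2)
        (Ici 0 ×ˢ univ) (0, x) L ∧
      ∀ (t : ℝ) (w : E), L (t, w) = w + t • generator E S x := by
  have hd : MDifferentiableWithinAt (𝓘(ℝ, ℝ).prod 𝓘(ℝ, E)) 𝓘(ℝ, E)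
      (fun p : ℝ × X => S p.1 p.2) (Ici 0 ×ˢ univ) (0, x) :=
    hS.smooth.mdifferentiableOn (by simp) (0, x) ⟨self_mem_Ici, mem_univ _⟩
  set L : ℝ × E →L[ℝ] E := mfderivWithin (𝓘(ℝ, ℝ).prod 𝓘(ℝ, E)) 𝓘(ℝ, E)
    (fun p : ℝ × X => S p.1 p.2) (Ici 0 ×ˢ univ) (0, x) with hLdef
  have hL : HasMFDerivWithinAt (𝓘(ℝ, ℝ).prod 𝓘(ℝ, E)) 𝓘(ℝ, E) (fun p : ℝ × X => S p.1 p.2)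
        (Ici 0 ×ˢ univ) (0, x) L := hd.hasMFDerivWithinAt
  refine ⟨L, hL, fun t w => ?_⟩
  have h1 : L (1, 0) = generator E S x := by
    have hf : HasMFDerivWithinAt 𝓘(ℝ, ℝ) (𝓘(ℝ, ℝ).prod 𝓘(ℝ, E)) (fun r : ℝ => (r, x)) (Ici 0) 0
        ((ContinuousLinearMap.id ℝ ℝ).prod (0 : ℝ →L[ℝ] E)) :=
      (hasMFDerivWithinAt_id (I := 𝓘(ℝ, ℝ)) (Ici (0 : ℝ)) (0 : ℝ)).prodMk
        (hasMFDerivWithinAt_const x _ _)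
    have h := (HasMFDerivWithinAt.comp (0 : ℝ) hL hf (fun r hr => mk_mem_prod hr (mem_univ _))).mfderivWithin
      (uniqueDiffOn_Ici 0 0 self_mem_Ici).uniqueMDiffWithinAt
    exact (congrArg (fun L : ℝ →L[ℝ] E => L 1) h).symm
  have h2 : L (0, w) = w := by
    have hf : HasMFDerivWithinAt 𝓘(ℝ, E) (𝓘(ℝ, ℝ).prod 𝓘(ℝ, E)) (fun y : X => ((0 : ℝ), y)) univ x
        ((0 : E →L[ℝ] ℝ).prod (ContinuousLinearMap.id ℝ E)) :=
      (hasMFDerivWithinAt_const (0 : ℝ) _ _).prodMk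
        (hasMFDerivWithinAt_id (I := 𝓘(ℝ, E)) univ x)
    have h := HasMFDerivWithinAt.comp x hL hf (fun y _ => mk_mem_prod self_mem_Ici (mem_univ _))
    have h' : HasMFDerivWithinAt 𝓘(ℝ, E) 𝓘(ℝ, E) (id : X → X) univ x
        (L.comp ((0 : E →L[ℝ] ℝ).prod (ContinuousLinearMap.id ℝ E))) :=
      h.congr_of_eventuallyEq (Eventually.of_forall fun y => (hS.zero y).symm) (hS.zero x).symm
    have h3 := (uniqueMDiffWithinAt_univ 𝓘(ℝ, E)).eq h' (hasMFDerivWithinAt_id univ x)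
    exact congrArg (fun L : E →L[ℝ] E => L w) h3
  have h3 : ((t, w) : ℝ × E) = (0, w) + t • (1, 0) := by simp
  rw [h3, map_add, map_smul, h1, h2]

lemma mfderivWithin_deform_zero (hS : IsSmoothSemigroup E S)
    (hγ : ContMDiffOn 𝓘(ℝ, ℝ) 𝓘(ℝ, E) ∞ γ (Icc 0 1)) (t : ℝ) (ht : 0 ≤ t) :
    (show E from mfderivWithin 𝓘(ℝ, ℝ) 𝓘(ℝ, E) (deform S γ t) (Icc 0 1) 0 (1 : ℝ)) =
      (show E from mfderivWithin 𝓘(ℝ, ℝ) 𝓘(ℝ, E) γ (Icc 0 1) 0 (1 : ℝ)) +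
        t • generator E S (γ 0) := by
  obtain ⟨L, hL, hLw⟩ := exists_derivative_flow hS (γ 0)
  have h0 : (0 : ℝ) ∈ Icc (0 : ℝ) 1 := ⟨le_rfl, zero_le_one⟩
  set w : ℝ →L[ℝ] E := mfderivWithin 𝓘(ℝ, ℝ) 𝓘(ℝ, E) γ (Icc 0 1) 0 with hw
  have hγd : HasMFDerivWithinAt 𝓘(ℝ, ℝ) 𝓘(ℝ, E) γ (Icc 0 1) 0 w :=
    (hγ.mdifferentiableOn (by simp) 0 h0).hasMFDerivWithinAt
  have hm : HasMFDerivWithinAt 𝓘(ℝ, ℝ) 𝓘(ℝ, ℝ) (fun s : ℝ => s * t) (Icc 0 1) 0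
      (t • ContinuousLinearMap.id ℝ ℝ) :=
    ((hasFDerivWithinAt_id (0 : ℝ) (Icc 0 1)).mul_const t).hasMFDerivWithinAt
  have hL' : HasMFDerivWithinAt (𝓘(ℝ, ℝ).prod 𝓘(ℝ, E)) 𝓘(ℝ, E) (fun p : ℝ × X => S p.1 p.2)
      (Ici 0 ×ˢ univ) (0 * t, γ 0) L := hasMFDerivWithinAt_of_eq (by simp) hL
  have h := (HasMFDerivWithinAt.comp (0 : ℝ) hL' (hm.prodMk hγd)
    (fun s hs => mk_mem_prod (mul_nonneg hs.1 ht) (mem_univ _))).mfderivWithin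
    (uniqueDiffOn_Icc zero_lt_one 0 h0).uniqueMDiffWithinAt
  have h' := congrArg (fun L : ℝ →L[ℝ] E => L 1) h
  refine h'.trans ?_
  have : (L.comp ((t • ContinuousLinearMap.id ℝ ℝ).prod w)) 1 = L (t, w 1) := by simp
  exact this.trans (hLw t (w 1))

/-- Trajectories of a smooth semigroup are integral curves of its generator. -/
lemma isMIntegralCurveOn_generator (hS : IsSmoothSemigroup E S) (u : X) :
    IsMIntegralCurveOn (I := 𝓘(ℝ, E)) (fun t => S t u) (fun x => generator E S x) (Ici 0) := by
  have hsm : ContMDiffOn 𝓘(ℝ, ℝ) 𝓘(ℝ, E) ∞ (fun t => S t u) (Ici 0) :=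
    hS.smooth.comp (f := fun t : ℝ => ((t, u) : ℝ × X))
      (contMDiff_id.prodMk contMDiff_const).contMDiffOn fun t ht => ⟨ht, mem_univ _⟩
  intro t ht
  have hd := (hsm.mdifferentiableOn (by simp) t ht).hasMFDerivWithinAt
  set m : ℝ →L[ℝ] E := mfderivWithin 𝓘(ℝ, ℝ) 𝓘(ℝ, E) (fun t => S t u) (Ici 0) t with hm
  have hd0 : HasMFDerivWithinAt 𝓘(ℝ, ℝ) 𝓘(ℝ, E) (fun t => S t u) (Ici 0) (t + 0) m :=
    hasMFDerivWithinAt_of_eq (by simp) hd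
  have hadd : HasMFDerivWithinAt 𝓘(ℝ, ℝ) 𝓘(ℝ, ℝ) (fun h : ℝ => t + h) (Ici 0) 0
      (ContinuousLinearMap.id ℝ ℝ) :=
    ((hasFDerivWithinAt_id (0 : ℝ) (Ici 0)).const_add t).hasMFDerivWithinAt
  have hcomp := HasMFDerivWithinAt.comp (0 : ℝ) hd0 hadd
    (fun h hh => show (0 : ℝ) ≤ t + h from add_nonneg ht hh)
  -- The trajectory of `u` after time `t` is the trajectory of `S t u` after time zero.
  have hcomp' : HasMFDerivWithinAt 𝓘(ℝ, ℝ) 𝓘(ℝ, E) (fun h => S h (S t u)) (Ici 0) 0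
      (m.comp (ContinuousLinearMap.id ℝ ℝ)) :=
    hcomp.congr_of_eventuallyEq
      (eventually_nhdsWithin_of_forall fun h hh => (hS.add t h ht hh u).symm)
      (hS.add t 0 ht le_rfl u).symm
  have hgen := congrArg (fun L : ℝ →L[ℝ] E => L 1)
    (hcomp'.mfderivWithin (uniqueDiffOn_Ici 0 0 self_mem_Ici).uniqueMDiffWithinAt)
  have hmeq : m = (1 : ℝ →L[ℝ] ℝ).smulRight (generator E S (S t u)) := by
    refine ContinuousLinearMap.ext_ring ?_
    have h1 : ((1 : ℝ →L[ℝ] ℝ).smulRight (generator E S (S t u))) 1 =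
      generator E S (S t u) := by simp
    exact (h1.trans hgen).symm
  exact hd.congr_mfderiv hmeq

end Gradient

/-! ### Identification of the generator with `-∇F`. -/

section GradientFlow

variable {E : Type*} [NormedAddCommGroup E] [NormedSpace ℝ E]
  {X : Type*} [MetricSpace X] [ChartedSpace E X] {S : ℝ → X → X} {γ : ℝ → X}
  [RiemannianBundle (fun x : X => TangentSpace 𝓘(ℝ, E) x)]

variable (E) in
/-- The generator of a semigroup, as a vector field. -/
def velocityField (S : ℝ → X → X) (x : X) : TangentSpace 𝓘(ℝ, E) x := generator E S x

variable (E) in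
/-- The differential of a function, as a linear form on the tangent space. -/
def differential (F : X → ℝ) (x : X) : TangentSpace 𝓘(ℝ, E) x →L[ℝ] ℝ :=
  mfderiv 𝓘(ℝ, E) 𝓘(ℝ, ℝ) F x

lemma action_zero_right (hS : IsSmoothSemigroup E S)
    (hγ : ContMDiffOn 𝓘(ℝ, ℝ) 𝓘(ℝ, E) ∞ γ (Icc 0 1)) {x : X} (hx : γ 0 = x)
    {w : TangentSpace 𝓘(ℝ, E) x}
    (hw : mfderivWithin 𝓘(ℝ, ℝ) 𝓘(ℝ, E) γ (Icc 0 1) 0 (1 : ℝ) = (w : E)) {t : ℝ} (ht : 0 ≤ t) :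
    action E S γ t 0 = ‖w + t • velocityField E S x‖ ^ 2 := by
  subst hx
  rw [action]
  congr 1
  refine norm_tangent_congr (by rw [deform, zero_mul, hS.zero]) ?_
  refine (mfderivWithin_deform_zero hS hγ t ht).trans ?_
  exact congrArg (fun v : E => v + t • generator E S (γ 0)) hw

/-- At `s = 0` the right-hand side of the action inequality vanishes and the action is `‖w + t • V‖
^ 2`, half of whose derivative at `t = 0` is `⟨V, w⟩`. -/
lemma inner_generator_add_mfderiv_nonpos (hS : IsSmoothSemigroup E S) {F : X → ℝ}
    (hF : ContMDiff 𝓘(ℝ, E) 𝓘(ℝ, ℝ) ∞ F) {lam : ℝ} (h : ActionInequalityAt E F lam S 0)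
    (hγ : ContMDiffOn 𝓘(ℝ, ℝ) 𝓘(ℝ, E) ∞ γ (Icc 0 1)) {x : X} (hx : γ 0 = x)
    {w : TangentSpace 𝓘(ℝ, E) x}
    (hw : mfderivWithin 𝓘(ℝ, ℝ) 𝓘(ℝ, E) γ (Icc 0 1) 0 (1 : ℝ) = (w : E)) :
    inner ℝ (velocityField E S x) w + differential E F x w ≤ 0 := by
  have h0 : (0 : ℝ) ∈ Icc (0 : ℝ) 1 := ⟨le_rfl, zero_le_one⟩
  have key := h γ hγ 0 h0
  set V : TangentSpace 𝓘(ℝ, E) x := velocityField E S x with hV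
  have hA : derivWithin (fun r => action E S γ r 0) (Ici 0) 0 = 2 * inner ℝ V w := by
    have hd : HasDerivWithinAt (fun t : ℝ => ‖w + t • V‖ ^ 2) (2 * inner ℝ V w) (Ici 0) 0 := by
      have hexp : (fun t : ℝ => ‖w + t • V‖ ^ 2) =
          fun t : ℝ => ‖w‖ ^ 2 + t * (2 * inner ℝ V w) + t ^ 2 * ‖V‖ ^ 2 := by
        funext t
        rw [norm_add_sq_real, inner_smul_right, norm_smul, mul_pow, Real.norm_eq_abs, sq_abs,
          real_inner_comm]
        ring
      rw [hexp]
      have := ((((hasDerivAt_id (0 : ℝ)).mul_const (2 * inner ℝ V w)).const_add (‖w‖ ^ 2)).add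
        (((hasDerivAt_id (0 : ℝ)).pow 2).mul_const (‖V‖ ^ 2))).hasDerivWithinAt (s := Ici 0)
      simpa using! this
    exact (hd.congr (fun t ht => action_zero_right hS hγ hx hw ht)
      (action_zero_right hS hγ hx hw le_rfl)).derivWithin (uniqueDiffOn_Ici 0 0 self_mem_Ici)
  have hFd : derivWithin (fun σ => F (deform S γ 0 σ)) (Icc 0 1) 0 =
      differential E F x w := by
    have hu : UniqueDiffWithinAt ℝ (Icc (0 : ℝ) 1) 0 := uniqueDiffOn_Icc zero_lt_one 0 h0
    have h1 : (fun σ => F (deform S γ 0 σ)) = F ∘ γ := funext fun σ => by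
      rw [deform_zero hS]
      rfl
    have h2 := mfderiv_comp_mfderivWithin_of_eq (I := 𝓘(ℝ, ℝ)) (I' := 𝓘(ℝ, E)) (I'' := 𝓘(ℝ, ℝ))
      (hF.mdifferentiable (by simp) x) (hγ.mdifferentiableOn (by simp) 0 h0)
      hu.uniqueMDiffWithinAt hx
    rw [mfderivWithin_eq_fderivWithin] at h2
    rw [h1, ← fderivWithin_derivWithin]
    refine (congrArg (fun L : ℝ →L[ℝ] ℝ => L 1) h2).trans ?_
    exact congrArg (fun v : E => (mfderiv 𝓘(ℝ, E) 𝓘(ℝ, ℝ) F x : E →L[ℝ] ℝ) v) hw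
  rw [hA, hFd, mul_zero, zero_mul] at key
  linarith

lemma inner_grad [FiniteDimensional ℝ E] (F : X → ℝ) (x : X) (w : TangentSpace 𝓘(ℝ, E) x) :
    inner ℝ (grad E F x) w = differential E F x w := by
  have : FiniteDimensional ℝ (TangentSpace 𝓘(ℝ, E) x) := inferInstanceAs (FiniteDimensional ℝ E)
  have : CompleteSpace (TangentSpace 𝓘(ℝ, E) x) := FiniteDimensional.complete ℝ _
  exact InnerProductSpace.toDual_symm_apply

variable [IsManifold 𝓘(ℝ, E) ∞ X]
  [IsContMDiffRiemannianBundle 𝓘(ℝ, E) ∞ E (fun x : X => TangentSpace 𝓘(ℝ, E) x)]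

/-- A chart segment with the prescribed direction. The factor `ε` keeps it in the chart up to `s =
1`, and is harmless since the inequality to be tested is linear in the velocity. -/
lemma exists_curve_velocity (x : X) (w : TangentSpace 𝓘(ℝ, E) x) :
    ∃ ε > (0 : ℝ), ∃ γ : ℝ → X, ContMDiffOn 𝓘(ℝ, ℝ) 𝓘(ℝ, E) ∞ γ (Icc 0 1) ∧ γ 0 = x ∧
      mfderivWithin 𝓘(ℝ, ℝ) 𝓘(ℝ, E) γ (Icc 0 1) 0 (1 : ℝ) = (ε • w : TangentSpace 𝓘(ℝ, E) x) := by
  set φ := extChartAt 𝓘(ℝ, E) x with hφ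
  obtain ⟨δ, hδ, hball⟩ := Metric.mem_nhds_iff.1 (extChartAt_target_mem_nhds (I := 𝓘(ℝ, E)) x)
  set L : E →L[ℝ] E := mfderiv 𝓘(ℝ, E) 𝓘(ℝ, E) φ x with hL
  set z : E := L w with hz
  set ε : ℝ := δ / (‖z‖ + 1) with hε
  have hε0 : 0 < ε := by positivity
  have hεz : ‖ε • z‖ < δ := by
    rw [norm_smul, Real.norm_eq_abs, abs_of_pos hε0, hε, div_mul_eq_mul_div,
      div_lt_iff₀ (by positivity)]
    nlinarith [norm_nonneg z]
  have h0 : (0 : ℝ) ∈ Icc (0 : ℝ) 1 := ⟨le_rfl, zero_le_one⟩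
  have hu : UniqueDiffWithinAt ℝ (Icc (0 : ℝ) 1) 0 := uniqueDiffOn_Icc zero_lt_one 0 h0
  set ℓ : ℝ → E := fun s => φ x + s • (ε • z) with hℓ
  have hℓs : ContDiff ℝ ∞ ℓ := contDiff_const.add (contDiff_id.smul contDiff_const)
  have hmem : ∀ s ∈ Icc (0 : ℝ) 1, ℓ s ∈ φ.target := fun s hs => hball (by
    rw [Metric.mem_ball, dist_eq_norm, hℓ, add_sub_cancel_left, norm_smul, Real.norm_eq_abs,
      abs_of_nonneg hs.1]
    exact (mul_le_of_le_one_left (norm_nonneg _) hs.2).trans_lt hεz)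
  have hγs : ContMDiffOn 𝓘(ℝ, ℝ) 𝓘(ℝ, E) ∞ (fun s => φ.symm (ℓ s)) (Icc 0 1) :=
    (contMDiffOn_extChartAt_symm x).comp hℓs.contMDiff.contMDiffOn hmem
  have hγ0 : φ.symm (ℓ 0) = x := by simp [hℓ, hφ]
  refine ⟨ε, hε0, fun s => φ.symm (ℓ s), hγs, hγ0, ?_⟩
  have h1 := mfderivWithin_extChartAt_comp (x₀ := x) (hγs.mdifferentiableOn (by simp) 0 h0) hu
    (by rw [hγ0]; exact mem_chart_source E x)
  have h2 : derivWithin (fun s => φ (φ.symm (ℓ s))) (Icc 0 1) 0 = ε • z := by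
    have h3 : HasDerivWithinAt ℓ (ε • z) (Icc 0 1) 0 := by
      have := (((hasDerivAt_id (0 : ℝ)).smul_const (ε • z)).const_add
        (φ x)).hasDerivWithinAt (s := Icc 0 1)
      rw [one_smul] at this
      exact this
    exact (h3.congr (fun s hs => φ.right_inv (hmem s hs)) (φ.right_inv (hmem 0 h0))).derivWithin hu
  -- The norm comparison at `x` is used only for injectivity of the chart derivative.
  obtain ⟨P, hP⟩ := exists_chart_norm_comparison E x one_lt_two
  set v : TangentSpace 𝓘(ℝ, E) x :=
    mfderivWithin 𝓘(ℝ, ℝ) 𝓘(ℝ, E) (fun s => φ.symm (ℓ s)) (Icc 0 1) 0 (1 : ℝ) with hv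
  have hpt : ∀ y : X, y = x → ∀ a : E,
      (mfderiv 𝓘(ℝ, E) 𝓘(ℝ, E) φ y : E →L[ℝ] E) a = L a := fun y hy a => by
    subst hy
    rfl
  have hLv : L v = ε • z := (hpt _ hγ0 v).symm.trans (h1.trans h2)
  have hdiff : L (v - ε • w) = 0 := by
    have : L (v - ε • w) = L v - ε • L w := by
      refine (map_sub L (v : E) (ε • w : TangentSpace 𝓘(ℝ, E) x)).trans ?_
      exact congrArg (fun q => L v - q) (map_smul L ε (w : E))
    rw [this, hLv, sub_self]
  have h5 := (hP.self_of_nhds (v - ε • w)).2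
  have h6 : ‖v - ε • w‖ ≤ 2 * ‖P 0‖ := h5.trans (congrArg (fun q : E => 2 * ‖P q‖) hdiff).le
  rw [map_zero, norm_zero, mul_zero] at h6
  have h7 : v - ε • w = 0 := norm_le_zero_iff.1 h6
  exact sub_eq_zero.1 h7

variable [FiniteDimensional ℝ E]

/-- Testing `⟨V + ∇F, w⟩ ≤ 0` with `w = V + ∇F` forces this vector to be zero. -/
lemma velocityField_eq_neg_grad (hS : IsSmoothSemigroup E S) {F : X → ℝ}
    (hF : ContMDiff 𝓘(ℝ, E) 𝓘(ℝ, ℝ) ∞ F) {lam : ℝ} (h : ActionInequalityAt E F lam S 0) (x : X) :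
    velocityField E S x = -grad E F x := by
  set V : TangentSpace 𝓘(ℝ, E) x := velocityField E S x with hV
  have hle : ∀ w : TangentSpace 𝓘(ℝ, E) x, inner ℝ (V + grad E F x) w ≤ 0 := by
    intro w
    obtain ⟨ε, hε, γ, hγ, hγ0, hγw⟩ := exists_curve_velocity x w
    have := inner_generator_add_mfderiv_nonpos hS hF h hγ hγ0 hγw
    rw [← inner_grad F x, ← inner_add_left, inner_smul_right] at this
    exact nonpos_of_mul_nonpos_right this hε
  have h0 := hle (V + grad E F x)
  rw [real_inner_self_nonpos] at h0
  exact eq_neg_of_add_eq_zero_left h0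

lemma isGradientFlow_of_actionInequalityAt (hS : IsSmoothSemigroup E S) {F : X → ℝ}
    (hF : ContMDiff 𝓘(ℝ, E) 𝓘(ℝ, ℝ) ∞ F) {lam : ℝ} (h : ActionInequalityAt E F lam S 0) :
    IsGradientFlow E F S := by
  intro u
  refine ⟨hS.zero u, ?_⟩
  have : (fun x : X => -grad E F x) =
      fun x : X => velocityField E S x :=
    funext fun x => (velocityField_eq_neg_grad hS hF h x).symm
  rw [this]
  exact isMIntegralCurveOn_generator hS u

end GradientFlow

/-! ### Energy estimates on `[0, ∞) × [0, 1]`. -/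

section Calculus

variable {f : ℝ × ℝ → ℝ} {t s h : ℝ}

lemma hasDerivWithinAt_fst (hf : ContDiffOn ℝ ∞ f deformDomain) (ht : 0 ≤ t)
    (hs : s ∈ Icc (0 : ℝ) 1) : HasDerivWithinAt (fun r => f (r, s))
      (fderivWithin ℝ f deformDomain (t, s) (1, 0)) (Ici 0) t :=
  ((hf.differentiableOn (by simp) (t, s) ⟨ht, hs⟩).hasFDerivWithinAt).comp_hasDerivWithinAt t
    ((hasDerivWithinAt_id t _).prodMk (hasDerivWithinAt_const t _ s)) fun _ hr => mk_mem_prod hr hs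

lemma hasDerivWithinAt_snd (hf : ContDiffOn ℝ ∞ f deformDomain) (ht : 0 ≤ t)
    (hs : s ∈ Icc (0 : ℝ) 1) : HasDerivWithinAt (fun σ => f (t, σ))
      (fderivWithin ℝ f deformDomain (t, s) (0, 1)) (Icc 0 1) s :=
  ((hf.differentiableOn (by simp) (t, s) ⟨ht, hs⟩).hasFDerivWithinAt).comp_hasDerivWithinAt s
    ((hasDerivWithinAt_const s _ t).prodMk (hasDerivWithinAt_id s _)) fun _ hr => mk_mem_prod ht hr

lemma continuousOn_fderivWithin_apply (hf : ContDiffOn ℝ ∞ f deformDomain) (e : ℝ × ℝ) :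
    ContinuousOn (fun p => fderivWithin ℝ f deformDomain p e) deformDomain :=
  (hf.continuousOn_fderivWithin uniqueDiffOn_deformDomain (by simp)).clm_apply continuousOn_const

/-- The increment in `t` of an integral over `s ∈ [0, 1]` is bounded through the integral of the
derivative in `t`. -/
lemma integral_sub_integral_le (hf : ContDiffOn ℝ ∞ f deformDomain) (hh : 0 ≤ h) {c : ℝ}
    (hc : ∀ t ∈ Icc 0 h, ∫ s in (0 : ℝ)..1, fderivWithin ℝ f deformDomain (t, s) (1, 0) ≤ c) :
    (∫ s in (0 : ℝ)..1, f (h, s)) - ∫ s in (0 : ℝ)..1, f (0, s) ≤ h * c := by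
  set b : ℝ → ℝ → ℝ := fun t s => fderivWithin ℝ f deformDomain (t, s) (1, 0) with hb
  have hbc : ContinuousOn (Function.uncurry b) deformDomain :=
    continuousOn_fderivWithin_apply hf (1, 0)
  have hfs : ∀ t, 0 ≤ t → ContinuousOn (fun s => f (t, s)) (uIcc 0 1) := fun t ht => by
    rw [uIcc_of_le zero_le_one]
    exact hf.continuousOn.comp (by fun_prop) fun s hs => ⟨ht, hs⟩
  have hftc : ∀ s ∈ Icc (0 : ℝ) 1, ∫ t in (0 : ℝ)..h, b t s = f (h, s) - f (0, s) := by
    intro s hs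
    refine intervalIntegral.integral_eq_sub_of_hasDerivAt_of_le (f := fun r => f (r, s)) hh
      (hf.continuousOn.comp (by fun_prop) fun r hr => ⟨hr.1, hs⟩)
      (fun r hr => (hasDerivWithinAt_fst hf hr.1.le hs).hasDerivAt (Ici_mem_nhds hr.1)) ?_
    refine ContinuousOn.intervalIntegrable ?_
    rw [uIcc_of_le hh]
    exact hbc.comp (f := fun r : ℝ => ((r, s) : ℝ × ℝ)) (by fun_prop) fun r hr => ⟨hr.1, hs⟩
  have hint : MeasureTheory.IntegrableOn (Function.uncurry b) (Icc 0 h ×ˢ Icc 0 1) :=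
    (hbc.mono (prod_mono Icc_subset_Ici_self subset_rfl)).integrableOn_compact
      (isCompact_Icc.prod isCompact_Icc)
  have hint' : MeasureTheory.IntegrableOn (Function.uncurry b) (uIoc 0 h ×ˢ uIoc 0 1) := by
    rw [uIoc_of_le hh, uIoc_of_le zero_le_one]
    exact hint.mono_set (prod_mono Ioc_subset_Icc_self Ioc_subset_Icc_self)
  have hswap := MeasureTheory.intervalIntegral_intervalIntegral_swap hint'
  have hinner : IntervalIntegrable (fun t => ∫ s in (0 : ℝ)..1, b t s) MeasureTheory.volume 0 h := by
    rw [uIoc_of_le hh, uIoc_of_le zero_le_one, MeasureTheory.IntegrableOn,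
      MeasureTheory.Measure.volume_eq_prod, ← MeasureTheory.Measure.prod_restrict] at hint'
    rw [intervalIntegrable_iff_integrableOn_Ioc_of_le hh]
    simp_rw [intervalIntegral.integral_of_le zero_le_one]
    exact hint'.integral_prod_left
  rw [← intervalIntegral.integral_sub (hfs h hh).intervalIntegrable
    (hfs 0 le_rfl).intervalIntegrable]
  calc ∫ s in (0 : ℝ)..1, (f (h, s) - f (0, s))
      = ∫ s in (0 : ℝ)..1, ∫ t in (0 : ℝ)..h, b t s :=
        intervalIntegral.integral_congr fun s hs => (hftc s (by
          rwa [uIcc_of_le zero_le_one] at hs)).symm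
    _ = ∫ t in (0 : ℝ)..h, ∫ s in (0 : ℝ)..1, b t s := hswap.symm
    _ ≤ ∫ _ in (0 : ℝ)..h, c :=
        intervalIntegral.integral_mono_on hh hinner intervalIntegrable_const hc
    _ = h * c := by simp

/-- The energy estimate obtained from the action inequality with the weight `1 + 2 lam s t`. -/
lemma weighted_energy_le {A f : ℝ × ℝ → ℝ} {lam h M c₀ c₁ : ℝ}
    (hA : ContDiffOn ℝ ∞ A deformDomain) (hf : ContDiffOn ℝ ∞ f deformDomain)
    (hA0 : ∀ p, 0 ≤ A p) (hh : 0 ≤ h) (hlam : |lam| * h ≤ 1 / 4)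
    (hineq : ∀ t, 0 ≤ t → ∀ s ∈ Icc (0 : ℝ) 1,
      1 / 2 * derivWithin (fun r => A (r, s)) (Ici 0) t
        + derivWithin (fun σ => f (t, σ)) (Icc 0 1) s ≤ -lam * s * A (t, s))
    (hM : ∀ t ∈ Icc 0 h, ∀ s ∈ Icc (0 : ℝ) 1, |f (t, s)| ≤ M)
    (hc₀ : ∀ t ∈ Icc 0 h, f (t, 0) ≤ c₀)
    (hc₁ : ∀ t ∈ Icc 0 h, c₁ ≤ (1 + 2 * lam * t) * f (t, 1)) :
    (∫ s in (0 : ℝ)..1, (1 + 2 * lam * s * h) * A (h, s)) - ∫ s in (0 : ℝ)..1, A (0, s) ≤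
      h * (2 * c₀ - 2 * c₁ + 4 * |lam| * h * M) := by
  set w : ℝ × ℝ → ℝ := fun p => 1 + 2 * lam * p.2 * p.1 with hw
  have hws : ContDiff ℝ ∞ w := by rw [hw]; fun_prop
  set B : ℝ × ℝ → ℝ := fun p => w p * A p with hB
  have hBs : ContDiffOn ℝ ∞ B deformDomain := hws.contDiffOn.mul hA
  have key := integral_sub_integral_le hBs hh (c := 2 * c₀ - 2 * c₁ + 4 * |lam| * h * M) ?_
  · have h0 : ∀ s : ℝ, B (0, s) = A (0, s) := fun s => by simp [hB, hw]
    simp only [h0] at key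
    exact key
  intro t ht
  have ht0 : 0 ≤ t := ht.1
  have hlt : |lam| * t ≤ 1 / 4 := (mul_le_mul_of_nonneg_left ht.2 (abs_nonneg _)).trans hlam
  have hltabs := abs_le.1 (show |lam * t| ≤ 1 / 4 by rwa [abs_mul, abs_of_nonneg ht0])
  -- `p` is the weight times `f`, so the integral of `p'` leaves only boundary values; the term from
  -- differentiating the weight is paid for by `M`.
  set p : ℝ → ℝ := fun s => (1 + 2 * lam * s * t) * f (t, s) with hp
  set p' : ℝ → ℝ := fun s => 2 * lam * t * f (t, s) +
    (1 + 2 * lam * s * t) * fderivWithin ℝ f deformDomain (t, s) (0, 1) with hp'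
  have hfc : ContinuousOn (fun s => f (t, s)) (Icc 0 1) :=
    hf.continuousOn.comp (by fun_prop) fun s hs => ⟨ht0, hs⟩
  have hdc : ∀ {g : ℝ × ℝ → ℝ}, ContDiffOn ℝ ∞ g deformDomain → ∀ e : ℝ × ℝ,
      ContinuousOn (fun s => fderivWithin ℝ g deformDomain (t, s) e) (Icc 0 1) := fun hg e =>
    (continuousOn_fderivWithin_apply hg e).comp (f := fun s : ℝ => ((t, s) : ℝ × ℝ))
      (by fun_prop) fun s hs => ⟨ht0, hs⟩
  have hp'c : ContinuousOn p' (Icc 0 1) :=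
    (continuousOn_const.mul hfc).add ((by fun_prop : ContinuousOn _ _).mul (hdc hf (0, 1)))
  have hder : ∀ s ∈ Icc (0 : ℝ) 1, HasDerivWithinAt p (p' s) (Icc 0 1) s := by
    intro s hs
    have h1 : HasDerivWithinAt (fun s : ℝ => 1 + 2 * lam * s * t) (2 * lam * t) (Icc 0 1) s := by
      have := ((((hasDerivAt_id s).const_mul (2 * lam)).mul_const t).const_add
        1).hasDerivWithinAt (s := Icc 0 1)
      simpa using! this
    exact h1.mul (hasDerivWithinAt_snd hf ht0 hs)
  have hp'int : ∫ s in (0 : ℝ)..1, p' s = p 1 - p 0 :=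
    intervalIntegral.integral_eq_sub_of_hasDerivAt_of_le zero_le_one
      (fun s hs => (hder s hs).continuousWithinAt)
      (fun s hs => (hder s ⟨hs.1.le, hs.2.le⟩).hasDerivAt (Icc_mem_nhds hs.1 hs.2))
      (by
        refine ContinuousOn.intervalIntegrable ?_
        rwa [uIcc_of_le zero_le_one])
  have hpoint : ∀ s ∈ Icc (0 : ℝ) 1, fderivWithin ℝ B deformDomain (t, s) (1, 0) ≤
      4 * |lam| * h * M - 2 * p' s := by
    intro s hs
    have hu : UniqueDiffWithinAt ℝ (Ici (0 : ℝ)) t := uniqueDiffOn_Ici 0 t ht0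
    have hus : UniqueDiffWithinAt ℝ (Icc (0 : ℝ) 1) s := uniqueDiffOn_Icc zero_lt_one s hs
    have hi := hineq t ht0 s hs
    have hAd := hasDerivWithinAt_fst hA ht0 hs
    rw [hAd.derivWithin hu, (hasDerivWithinAt_snd hf ht0 hs).derivWithin hus] at hi
    have h1 : HasDerivWithinAt (fun r : ℝ => 1 + 2 * lam * s * r) (2 * lam * s) (Ici 0) t := by
      have := (((hasDerivAt_id t).const_mul (2 * lam * s)).const_add
        1).hasDerivWithinAt (s := Ici 0)
      simpa using! this
    have h2 : fderivWithin ℝ B deformDomain (t, s) (1, 0) = 2 * lam * s * A (t, s) +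
        (1 + 2 * lam * s * t) * fderivWithin ℝ A deformDomain (t, s) (1, 0) :=
      hu.eq_deriv _ (hasDerivWithinAt_fst hBs ht0 hs) (h1.mul hAd)
    have hw0 : 0 ≤ 1 + 2 * lam * s * t := by
      have : -(1 / 4) ≤ s * (lam * t) := by nlinarith [hs.1, hs.2]
      linarith
    have h3 := mul_le_mul_of_nonneg_left hi hw0
    have h4 : lam * t * f (t, s) ≤ |lam| * h * M := by
      refine (le_abs_self _).trans ?_
      rw [abs_mul, abs_mul, abs_of_nonneg ht0]
      have hM0 : 0 ≤ M := (abs_nonneg _).trans (hM t ht s hs)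
      exact mul_le_mul (mul_le_mul_of_nonneg_left ht.2 (abs_nonneg _)) (hM t ht s hs)
        (abs_nonneg _) (mul_nonneg (abs_nonneg _) hh)
    -- The weight truncates `exp (2 * lam * s * t)`; the resulting defect `-4 * (lam * s) ^ 2 * t *
    -- A` has the favourable sign.
    have h5 : 0 ≤ (lam * s) ^ 2 * t * A (t, s) :=
      mul_nonneg (mul_nonneg (sq_nonneg _) ht0) (hA0 _)
    rw [h2]
    simp only [hp']
    nlinarith
  calc ∫ s in (0 : ℝ)..1, fderivWithin ℝ B deformDomain (t, s) (1, 0)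
      ≤ ∫ s in (0 : ℝ)..1, (4 * |lam| * h * M - 2 * p' s) := by
        refine intervalIntegral.integral_mono_on zero_le_one ?_ ?_ hpoint
        · refine ContinuousOn.intervalIntegrable ?_
          rw [uIcc_of_le zero_le_one]
          exact hdc hBs (1, 0)
        · refine ContinuousOn.intervalIntegrable ?_
          rw [uIcc_of_le zero_le_one]
          exact continuousOn_const.sub (continuousOn_const.mul hp'c)
    _ = 4 * |lam| * h * M - 2 * (p 1 - p 0) := by
        rw [intervalIntegral.integral_sub intervalIntegrable_const, intervalIntegral.integral_const,
          intervalIntegral.integral_const_mul, hp'int]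
        · simp
        · refine ContinuousOn.intervalIntegrable ?_
          rw [uIcc_of_le zero_le_one]
          exact continuousOn_const.mul hp'c
    _ ≤ _ := by
        have e0 : p 0 = f (t, 0) := by simp [hp]
        have e1 : p 1 = (1 + 2 * lam * t) * f (t, 1) := by simp [hp]
        rw [e0, e1]
        linarith [hc₀ t ht, hc₁ t ht]

/-- A weighted energy bounds the square of a length from above. -/
lemma sq_mul_le_weighted_energy {a : ℝ → ℝ} (ha : ContinuousOn a (Icc 0 1)) (ha0 : ∀ s, 0 ≤ a s)
    {lam h d : ℝ} (hh : 0 ≤ h) (hlam : |lam| * h ≤ 1 / 4) (hd : 0 ≤ d)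
    (hle : d ≤ ∫ s in (0 : ℝ)..1, √(a s)) :
    d ^ 2 * (1 + lam * h - 4 * (lam * h) ^ 2) ≤
      ∫ s in (0 : ℝ)..1, (1 + 2 * lam * s * h) * a s := by
  set y := lam * h with hy
  have hyabs := abs_le.1 (show |y| ≤ 1 / 4 by rwa [hy, abs_mul, abs_of_nonneg hh])
  -- Cauchy–Schwarz in linear form: `W * q ^ 2 ≥ 2 * c * q - c ^ 2 / W` for a weight `W > 0` and
  -- every `c`. The optimal `c` is `d` over the integral of `1 / W`, which is `d * (1 + y)` to first
  -- order.
  set c := d * (1 + y) with hc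
  have hc0 : 0 ≤ c := mul_nonneg hd (by linarith)
  have hsq : ContinuousOn (fun s => √(a s)) (Icc 0 1) := Real.continuous_sqrt.comp_continuousOn ha
  have hpoint : ∀ s ∈ Icc (0 : ℝ) 1,
      2 * c * √(a s) - c ^ 2 * (1 - 2 * y * s + 8 * y ^ 2 * s ^ 2) ≤
        (1 + 2 * lam * s * h) * a s := by
    intro s hs
    obtain ⟨q, hq, hq0⟩ : ∃ q, √(a s) = q ∧ 0 ≤ q := ⟨_, rfl, Real.sqrt_nonneg _⟩
    have haq : a s = q ^ 2 := by rw [← hq, Real.sq_sqrt (ha0 s)]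
    rw [hq, haq]
    set x := 2 * y * s with hx
    have hxl : -(1 / 2) ≤ x := by nlinarith [hs.1, hs.2]
    have hxw : 1 + 2 * lam * s * h = 1 + x := by rw [hx, hy]; ring
    have hx2 : 1 - 2 * y * s + 8 * y ^ 2 * s ^ 2 = 1 - x + 2 * x ^ 2 := by rw [hx]; ring
    rw [hxw, hx2]
    have hwpos : 0 < 1 + x := by linarith
    -- The product is `1 + x ^ 2 * (1 + 2 * x)`, whence the need for `x ≥ -1/2`; it gives a
    -- polynomial upper bound for the inverse weight.
    have h1 : 1 ≤ (1 + x) * (1 - x + 2 * x ^ 2) := by nlinarith [sq_nonneg x]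
    have h2 : 0 ≤ ((1 + x) * q - c) ^ 2 + c ^ 2 * ((1 + x) * (1 - x + 2 * x ^ 2) - 1) :=
      add_nonneg (sq_nonneg _) (mul_nonneg (sq_nonneg _) (by linarith))
    have h3 : 0 ≤ (1 + x) * ((1 + x) * q ^ 2 - (2 * c * q - c ^ 2 * (1 - x + 2 * x ^ 2))) := by
      nlinarith
    have := nonneg_of_mul_nonneg_right h3 hwpos
    linarith
  have hint1 : IntervalIntegrable (fun s => 2 * c * √(a s)) MeasureTheory.volume 0 1 := by
    refine ContinuousOn.intervalIntegrable ?_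
    rw [uIcc_of_le zero_le_one]
    exact continuousOn_const.mul hsq
  have hint2 : IntervalIntegrable (fun s : ℝ => c ^ 2 * (1 - 2 * y * s + 8 * y ^ 2 * s ^ 2))
      MeasureTheory.volume 0 1 := Continuous.intervalIntegrable (by fun_prop) _ _
  have hpoly : ∫ s in (0 : ℝ)..1, c ^ 2 * (1 - 2 * y * s + 8 * y ^ 2 * s ^ 2) =
      c ^ 2 * (1 - y + 8 / 3 * y ^ 2) := by
    have hder : ∀ s ∈ uIcc (0 : ℝ) 1, HasDerivAt
        (fun s : ℝ => c ^ 2 * (s - y * s ^ 2 + 8 / 3 * y ^ 2 * s ^ 3))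
        (c ^ 2 * (1 - 2 * y * s + 8 * y ^ 2 * s ^ 2)) s := by
      intro s _
      have := ((((hasDerivAt_id s).sub (((hasDerivAt_id s).pow 2).const_mul y)).add
        (((hasDerivAt_id s).pow 3).const_mul (8 / 3 * y ^ 2))).const_mul (c ^ 2))
      refine this.congr_deriv ?_
      simp only [id_eq, Nat.cast_ofNat, Nat.add_one_sub_one]
      ring
    rw [intervalIntegral.integral_eq_sub_of_hasDerivAt hder hint2]
    ring
  have hmono : ∫ s in (0 : ℝ)..1, (2 * c * √(a s) -
      c ^ 2 * (1 - 2 * y * s + 8 * y ^ 2 * s ^ 2)) ≤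
      ∫ s in (0 : ℝ)..1, (1 + 2 * lam * s * h) * a s := by
    refine intervalIntegral.integral_mono_on zero_le_one (hint1.sub hint2) ?_ hpoint
    refine ContinuousOn.intervalIntegrable ?_
    rw [uIcc_of_le zero_le_one]
    exact (by fun_prop : ContinuousOn _ _).mul ha
  rw [intervalIntegral.integral_sub hint1 hint2, intervalIntegral.integral_const_mul, hpoly]
    at hmono
  have h4 : 2 * c * d ≤ 2 * c * ∫ s in (0 : ℝ)..1, √(a s) :=
    mul_le_mul_of_nonneg_left hle (by linarith)
  have h5 : d ^ 2 * (1 + y - 4 * y ^ 2) ≤ 2 * c * d - c ^ 2 * (1 - y + 8 / 3 * y ^ 2) := by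
    have h6 : 0 ≤ d ^ 2 * (y ^ 2 * (7 / 3 - 13 / 3 * y - 8 / 3 * y ^ 2)) := by
      refine mul_nonneg (sq_nonneg _) (mul_nonneg (sq_nonneg _) ?_)
      nlinarith
    rw [hc]
    nlinarith
  linarith

end Calculus

/-! ### The Evolution Variational Inequality and geodesic convexity. -/

section EVI

variable {E : Type*} [NormedAddCommGroup E] [NormedSpace ℝ E]
  {X : Type*} [MetricSpace X] [ChartedSpace E X]
  [RiemannianBundle (fun x : X => TangentSpace 𝓘(ℝ, E) x)]
  [IsRiemannianManifold 𝓘(ℝ, E) X]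
  {S : ℝ → X → X} {γ : ℝ → X}

lemma dist_le_integral_norm_mfderivWithin
    (hγ : ContMDiffOn 𝓘(ℝ, ℝ) 𝓘(ℝ, E) ∞ γ (Icc 0 1))
    (hc : ContinuousOn (fun s => ‖mfderivWithin 𝓘(ℝ, ℝ) 𝓘(ℝ, E) γ (Icc 0 1) s (1 : ℝ)‖)
      (Icc 0 1)) :
    dist (γ 0) (γ 1) ≤
      ∫ s in (0 : ℝ)..1, ‖mfderivWithin 𝓘(ℝ, ℝ) 𝓘(ℝ, E) γ (Icc 0 1) s (1 : ℝ)‖ := by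
  have h := edist_le_pathELength E (hγ.of_le (by simp)) zero_le_one
  rw [pathELength_eq_lintegral_mfderivWithin_Icc, edist_dist] at h
  simp only [← ofReal_norm] at h
  have h' := h.trans_eq (MeasureTheory.ofReal_integral_eq_lintegral_ofReal
    (hc.integrableOn_compact isCompact_Icc) (Eventually.of_forall fun s => norm_nonneg _)).symm
  rw [intervalIntegral.integral_of_le zero_le_one, ← MeasureTheory.integral_Icc_eq_integral_Ioc]
  exact (ENNReal.ofReal_le_ofReal_iff
    (MeasureTheory.integral_nonneg fun s => norm_nonneg _)).1 h'

lemma dist_le_of_norm_mfderiv_le (hγ : ContMDiff 𝓘(ℝ, ℝ) 𝓘(ℝ, E) ∞ γ) {k : ℝ}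
    (hk : ∀ s, ‖mfderiv 𝓘(ℝ, ℝ) 𝓘(ℝ, E) γ s (1 : ℝ)‖ ≤ k) {s : ℝ} (hs : s ∈ Icc (0 : ℝ) 1) :
    dist (γ 0) (γ s) ≤ k := by
  have hk0 : 0 ≤ k := (norm_nonneg _).trans (hk 0)
  have h := edist_le_pathELength E ((hγ.of_le (by simp)).contMDiffOn (s := Icc 0 s)) hs.1
  have h1 : pathELength 𝓘(ℝ, E) γ 0 s ≤ ENNReal.ofReal k := by
    refine (pathELength_mono le_rfl hs.2).trans ?_
    rw [pathELength_eq_lintegral_mfderiv_Icc]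
    calc ∫⁻ s in Icc (0 : ℝ) 1, ‖mfderiv 𝓘(ℝ, ℝ) 𝓘(ℝ, E) γ s (1 : ℝ)‖ₑ
        ≤ ∫⁻ _ in Icc (0 : ℝ) 1, ENNReal.ofReal k := by
          refine MeasureTheory.lintegral_mono fun s => ?_
          simp only [← ofReal_norm]
          exact ENNReal.ofReal_le_ofReal (hk s)
      _ = ENNReal.ofReal k := by simp
  have h2 := h.trans h1
  rw [edist_dist] at h2
  exact (ENNReal.ofReal_le_ofReal_iff hk0).1 h2

variable [IsManifold 𝓘(ℝ, E) ∞ X]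
  [IsContMDiffRiemannianBundle 𝓘(ℝ, E) ∞ E (fun x : X => TangentSpace 𝓘(ℝ, E) x)]

lemma dist_le_integral_sqrt_action (hS : IsSmoothSemigroup E S)
    (hγ : ContMDiffOn 𝓘(ℝ, ℝ) 𝓘(ℝ, E) ∞ γ (Icc 0 1)) {h : ℝ} (hh : 0 ≤ h) :
    dist (S h (γ 1)) (γ 0) ≤ ∫ s in (0 : ℝ)..1, √(action E S γ h s) := by
  have hsqrt : ∀ s, √(action E S γ h s) =
      ‖mfderivWithin 𝓘(ℝ, ℝ) 𝓘(ℝ, E) (deform S γ h) (Icc 0 1) s (1 : ℝ)‖ := fun s =>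
    Real.sqrt_sq (norm_nonneg _)
  have hc : ContinuousOn (fun s => √(action E S γ h s)) (Icc 0 1) :=
    Real.continuous_sqrt.comp_continuousOn ((contDiffOn_action hS hγ).continuousOn.comp
      (f := fun s : ℝ => ((h, s) : ℝ × ℝ)) (by fun_prop) fun s hs => ⟨hh, hs⟩)
  have := dist_le_integral_norm_mfderivWithin (contMDiffOn_deform_right hS hγ hh)
    (by simpa only [hsqrt] using hc)
  simp only [← hsqrt] at this
  have h0 : deform S γ h 0 = γ 0 := by rw [deform, zero_mul, hS.zero]
  have h1 : deform S γ h 1 = S h (γ 1) := by rw [deform, one_mul]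
  rw [h0, h1, dist_comm] at this
  exact this

/-- The two energy estimates combined for one curve. The error involves the curve only through `k`
and `M`, which allows `k` to decrease to the distance afterwards. -/
lemma dist_sq_le_of_smoothlyJoined (hS : IsSmoothSemigroup E S) {F : X → ℝ}
    (hF : ContMDiff 𝓘(ℝ, E) 𝓘(ℝ, ℝ) ∞ F) {lam : ℝ}
    (hact : ∀ t : ℝ, 0 ≤ t → ActionInequalityAt E F lam S t) {u v : X} {k h M c₁ : ℝ}
    (hjoin : SmoothlyJoined E v u 1 k) (hh : 0 ≤ h) (hh1 : h ≤ 1) (hlam : |lam| * h ≤ 1 / 4)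
    (hM : ∀ t ∈ Icc (0 : ℝ) 1, ∀ x ∈ Metric.closedBall v k, |F (S t x)| ≤ M)
    (hc₁ : ∀ t ∈ Icc 0 h, c₁ ≤ (1 + 2 * lam * t) * F (S t u)) :
    dist (S h u) v ^ 2 * (1 + lam * h - 4 * (lam * h) ^ 2) ≤
      k ^ 2 + h * (2 * F v - 2 * c₁ + 4 * |lam| * h * M) := by
  obtain ⟨γ, hγ, ⟨δ, hδ, h0, h1⟩, hk⟩ := hjoin
  have hγ0 : γ 0 = v := h0 0 hδ
  have hγ1 : γ 1 = u := h1 1 (by linarith)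
  have hγ' : ContMDiffOn 𝓘(ℝ, ℝ) 𝓘(ℝ, E) ∞ γ (Icc 0 1) := hγ.contMDiffOn
  have hA := contDiffOn_action hS hγ'
  have hAc : ∀ t, 0 ≤ t → ContinuousOn (fun s => action E S γ t s) (Icc 0 1) := fun t ht =>
    hA.continuousOn.comp (f := fun s : ℝ => ((t, s) : ℝ × ℝ)) (by fun_prop)
      fun s hs => ⟨ht, hs⟩
  have hA0 : ∀ t s, 0 ≤ action E S γ t s := fun t s => sq_nonneg _
  have henergy := weighted_energy_le (M := M) (c₀ := F v) (c₁ := c₁) hA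
    (contDiffOn_comp_deform hS hF hγ') (fun p => hA0 _ _) hh hlam
    (fun t ht s hs => hact t ht γ hγ' s hs)
    (fun t ht s hs => hM _ ⟨mul_nonneg hs.1 ht.1, mul_le_one₀ hs.2 ht.1 (ht.2.trans hh1)⟩ _
      (Metric.mem_closedBall'.2 (by
        rw [← hγ0]
        exact dist_le_of_norm_mfderiv_le hγ hk hs)))
    (fun t ht => by
      simp only [deform, zero_mul, hS.zero, hγ0]
      exact le_rfl)
    (fun t ht => by
      simp only [deform, one_mul, hγ1]
      exact hc₁ t ht)
  have hlen := dist_le_integral_sqrt_action hS hγ' hh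
  rw [hγ0, hγ1] at hlen
  have hlow := sq_mul_le_weighted_energy (hAc h hh) (hA0 h) hh hlam dist_nonneg hlen
  have hup : ∫ s in (0 : ℝ)..1, action E S γ 0 s ≤ k ^ 2 := by
    calc ∫ s in (0 : ℝ)..1, action E S γ 0 s ≤ ∫ _ in (0 : ℝ)..1, k ^ 2 := by
          refine intervalIntegral.integral_mono_on zero_le_one ?_ intervalIntegrable_const
            fun s hs => action_zero_le hS hγ hk hs
          refine ContinuousOn.intervalIntegrable ?_
          rw [uIcc_of_le zero_le_one]
          exact hAc 0 le_rfl
      _ = k ^ 2 := by simp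
  linarith

/-- The short-time form of the Evolution Variational Inequality. -/
lemma exists_dist_sq_le [ProperSpace X] (hS : IsSmoothSemigroup E S) {F : X → ℝ}
    (hF : ContMDiff 𝓘(ℝ, E) 𝓘(ℝ, ℝ) ∞ F) {lam : ℝ}
    (hact : ∀ t : ℝ, 0 ≤ t → ActionInequalityAt E F lam S t) (u v : X) :
    ∃ C : ℝ, ∀ᶠ h in 𝓝[>] (0 : ℝ),
      dist (S h u) v ^ 2 * (1 + lam * h - 4 * (lam * h) ^ 2) ≤
        dist u v ^ 2 + 2 * h * (F v - F u) + C * h ^ 2 := by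
  set D := dist v u with hD
  obtain ⟨M, hM⟩ : ∃ M, ∀ t ∈ Icc (0 : ℝ) 1, ∀ x ∈ Metric.closedBall v (D + 1),
      |F (S t x)| ≤ M := by
    have hcont : ContinuousOn (fun p : ℝ × X => F (S p.1 p.2))
        (Icc (0 : ℝ) 1 ×ˢ Metric.closedBall v (D + 1)) :=
      hF.continuous.comp_continuousOn (hS.smooth.continuousOn.mono
        (prod_mono Icc_subset_Ici_self (subset_univ _)))
    obtain ⟨M, hM⟩ := (isCompact_Icc.prod (isCompact_closedBall v (D + 1))).exists_bound_of_continuousOn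
      hcont
    exact ⟨M, fun t ht x hx => hM (t, x) ⟨ht, hx⟩⟩
  -- A linear error here suffices, as it is multiplied by `h` in the energy estimate.
  obtain ⟨C₁, hC₁⟩ : ∃ C₁, ∀ᶠ t in 𝓝[≥] (0 : ℝ),
      F u - C₁ * t ≤ (1 + 2 * lam * t) * F (S t u) := by
    have hq : DifferentiableWithinAt ℝ (fun t => (1 + 2 * lam * t) * F (S t u)) (Ici 0) 0 :=
      (by fun_prop : DifferentiableWithinAt ℝ (fun t : ℝ => 1 + 2 * lam * t) (Ici 0) 0).mul
        ((contDiffOn_comp_trajectory hS hF u).differentiableOn (by simp) 0 self_mem_Ici)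
    obtain ⟨C₁, hC₁⟩ := hq.isBigO_sub.bound
    refine ⟨C₁, ?_⟩
    filter_upwards [hC₁, self_mem_nhdsWithin] with t ht ht0
    rw [Real.norm_eq_abs, Real.norm_eq_abs, sub_zero,
      abs_of_nonneg (show 0 ≤ t from ht0), mul_zero, add_zero,
      one_mul, hS.zero] at ht
    linarith [(abs_le.1 ht).1]
  obtain ⟨τ, hτ, hτC⟩ : ∃ τ > 0, ∀ t ∈ Ico (0 : ℝ) τ,
      F u - C₁ * t ≤ (1 + 2 * lam * t) * F (S t u) := by
    obtain ⟨τ, hτ, h⟩ := mem_nhdsGE_iff_exists_Ico_subset.1 hC₁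
    exact ⟨τ, hτ, fun t ht => h ht⟩
  set C := 2 * |C₁| + 4 * |lam| * M with hC
  refine ⟨C, ?_⟩
  have hτ1 : 0 < min (min τ 1) (1 / (4 * (|lam| + 1))) := by positivity
  filter_upwards [Ioo_mem_nhdsGT hτ1] with h hh
  have hh0 : 0 < h := hh.1
  obtain ⟨hh12, hh3⟩ := lt_min_iff.1 hh.2
  obtain ⟨hhτ, hh1⟩ := lt_min_iff.1 hh12
  have hlam : |lam| * h ≤ 1 / 4 := by
    rw [lt_div_iff₀ (by positivity)] at hh3
    nlinarith [abs_nonneg lam]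
  -- `M`, `C₁` and the range of `h` do not depend on `k`, so `k` tends to `D` with `h` fixed.
  have hk : ∀ k, D < k → k ≤ D + 1 →
      dist (S h u) v ^ 2 * (1 + lam * h - 4 * (lam * h) ^ 2) ≤
        k ^ 2 + h * (2 * F v - 2 * (F u - |C₁| * h) + 4 * |lam| * h * M) := by
    intro k hk hk1
    refine dist_sq_le_of_smoothlyJoined hS hF hact (smoothlyJoined_of_dist_lt E hk) hh0.le hh1.le
      hlam (fun t ht x hx => hM t ht x (Metric.closedBall_subset_closedBall hk1 hx))
      fun t ht => ?_
    have h1 := hτC t ⟨ht.1, ht.2.trans_lt hhτ⟩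
    have h2 : C₁ * t ≤ |C₁| * h :=
      mul_le_mul (le_abs_self _) ht.2 ht.1 (abs_nonneg _)
    linarith
  have hlim : Tendsto (fun k : ℝ => k ^ 2 +
      h * (2 * F v - 2 * (F u - |C₁| * h) + 4 * |lam| * h * M)) (𝓝[>] D)
      (𝓝 (D ^ 2 + h * (2 * F v - 2 * (F u - |C₁| * h) + 4 * |lam| * h * M))) :=
    (((continuous_id.pow 2).add continuous_const).tendsto _).mono_left nhdsWithin_le_nhds
  have hfin := ge_of_tendsto hlim (by
    filter_upwards [Ioo_mem_nhdsGT (show D < D + 1 by linarith)] with k hkD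
    exact hk k hkD.1 hkD.2.le)
  rw [dist_comm u v]
  refine hfin.trans (le_of_eq ?_)
  rw [hC]
  ring

/-- The difference quotients of the squared distance from a trajectory have an upper bound that
converges to the bound of the Evolution Variational Inequality. -/
lemma exists_quotient_bound [ProperSpace X] (hS : IsSmoothSemigroup E S) {F : X → ℝ}
    (hF : ContMDiff 𝓘(ℝ, E) 𝓘(ℝ, ℝ) ∞ F) {lam : ℝ}
    (hact : ∀ t : ℝ, 0 ≤ t → ActionInequalityAt E F lam S t) (u v : X) :
    ∃ ρ : ℝ → ℝ, Tendsto ρ (𝓝[>] 0) (𝓝 (2 * (F v - F u) - lam * dist u v ^ 2)) ∧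
      ∀ᶠ h in 𝓝[>] (0 : ℝ), (dist (S h u) v ^ 2 - dist u v ^ 2) / h ≤ ρ h := by
  obtain ⟨C, hC⟩ := exists_dist_sq_le hS hF hact u v
  -- The correction terms multiply the squared distance at time `h`, not zero; continuity of the
  -- trajectory settles the limit.
  refine ⟨fun h => 2 * (F v - F u) + C * h - (lam - 4 * lam ^ 2 * h) * dist (S h u) v ^ 2, ?_, ?_⟩
  · have hcont : Tendsto (fun h => S h u) (𝓝[>] 0) (𝓝 (S 0 u)) := by
      have h1 : ContinuousOn (fun h => S h u) (Ici 0) :=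
        hS.smooth.continuousOn.comp (f := fun t : ℝ => ((t, u) : ℝ × X)) (by fun_prop)
          fun t ht => ⟨ht, mem_univ _⟩
      exact (h1 0 self_mem_Ici).mono_left (nhdsWithin_mono _ Ioi_subset_Ici_self)
    rw [hS.zero] at hcont
    have hd : Tendsto (fun h => dist (S h u) v ^ 2) (𝓝[>] 0) (𝓝 (dist u v ^ 2)) :=
      (hcont.dist tendsto_const_nhds).pow 2
    have hid : Tendsto (fun h : ℝ => h) (𝓝[>] 0) (𝓝 0) := nhdsWithin_le_nhds
    have := ((tendsto_const_nhds (x := 2 * (F v - F u))).add (hid.const_mul C)).sub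
      (((tendsto_const_nhds (x := lam)).sub (hid.const_mul (4 * lam ^ 2))).mul hd)
    simpa using this
  · filter_upwards [hC, self_mem_nhdsWithin] with h hh h0
    rw [div_le_iff₀ h0]
    nlinarith

lemma satisfiesEVI_of_actionInequalityAt [ProperSpace X] (hS : IsSmoothSemigroup E S) {F : X → ℝ}
    (hF : ContMDiff 𝓘(ℝ, E) 𝓘(ℝ, ℝ) ∞ F) {lam : ℝ}
    (hact : ∀ t : ℝ, 0 ≤ t → ActionInequalityAt E F lam S t) : SatisfiesEVI F lam S := by
  intro u v t ht
  obtain ⟨ρ, hρ, hle⟩ := exists_quotient_bound hS hF hact (S t u) v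
  set c := 2 * (F v - F (S t u)) - lam * dist (S t u) v ^ 2 with hc
  have hlim : upperRightDeriv (fun r => dist (S r u) v ^ 2) t ≤ (c : EReal) := by
    have h1 : Tendsto (fun h => (ρ h : EReal)) (𝓝[>] 0) (𝓝 (c : EReal)) :=
      (continuous_coe_real_ereal.tendsto c).comp hρ
    rw [← h1.limsup_eq]
    refine limsup_le_limsup ?_
    filter_upwards [hle, self_mem_nhdsWithin] with h hh h0
    rw [hS.add t h ht (le_of_lt h0)]
    exact EReal.coe_le_coe_iff.2 hh
  have hhalf : ((1 / 2 : ℝ) : EReal) * upperRightDeriv (fun r => dist (S r u) v ^ 2) t ≤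
      ((1 / 2 * c : ℝ) : EReal) := by
    rw [EReal.coe_mul]
    exact mul_le_mul_of_nonneg_left hlim (EReal.coe_nonneg.2 (by norm_num))
  refine (add_le_add_left hhalf _).trans ?_
  rw [← EReal.coe_add, EReal.coe_le_coe_iff, hc]
  linarith

lemma geodesicallyConvex_of_actionInequalityAt [ProperSpace X] (hS : IsSmoothSemigroup E S)
    {F : X → ℝ} (hF : ContMDiff 𝓘(ℝ, E) 𝓘(ℝ, ℝ) ∞ F) {lam : ℝ}
    (hact : ∀ t : ℝ, 0 ≤ t → ActionInequalityAt E F lam S t) : GeodesicallyConvex F lam := by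
  intro γ hγ s hs
  set D := dist (γ 0) (γ 1) with hD
  have hs1 : 0 ≤ 1 - s := by linarith [hs.2]
  have hd0 : dist (γ s) (γ 0) = s * D := by
    rw [hγ s hs 0 ⟨le_rfl, zero_le_one⟩, sub_zero, abs_of_nonneg hs.1]
  have hd1 : dist (γ s) (γ 1) = (1 - s) * D := by
    rw [hγ s hs 1 ⟨zero_le_one, le_rfl⟩, abs_sub_comm, abs_of_nonneg hs1]
  obtain ⟨ρ₀, hρ₀, hle₀⟩ := exists_quotient_bound hS hF hact (γ s) (γ 0)
  obtain ⟨ρ₁, hρ₁, hle₁⟩ := exists_quotient_bound hS hF hact (γ s) (γ 1)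
  have hlim := (hρ₀.const_mul (1 - s)).add (hρ₁.const_mul s)
  have hnonneg := ge_of_tendsto hlim (b := 0) (by
    filter_upwards [hle₀, hle₁, self_mem_nhdsWithin] with h h0 h1 hh
    have hh' : 0 < h := hh
    rw [div_le_iff₀ hh'] at h0 h1
    rw [hd0] at h0
    rw [hd1] at h1
    set a := dist (S h (γ s)) (γ 0)
    set b := dist (S h (γ s)) (γ 1)
    have htri : D ≤ a + b := dist_triangle_left _ _ _
    have hD0 : 0 ≤ D := dist_nonneg
    have hsq : D ^ 2 ≤ (a + b) ^ 2 := pow_le_pow_left₀ hD0 htri 2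
    have hss : 0 ≤ s * (1 - s) := mul_nonneg hs.1 hs1
    -- The point `γ s` minimises this weighted sum: `(1 - s) * a ^ 2 + s * b ^ 2 - s * (1 - s) * (a
    -- + b) ^ 2` is the square of `(1 - s) * a - s * b`. The weighted difference quotients are thus
    -- nonnegative.
    have hconv : s * (1 - s) * D ^ 2 ≤ (1 - s) * a ^ 2 + s * b ^ 2 := by
      nlinarith [mul_le_mul_of_nonneg_left hsq hss, sq_nonneg ((1 - s) * a - s * b)]
    have e0 := mul_le_mul_of_nonneg_left h0 hs1
    have e1 := mul_le_mul_of_nonneg_left h1 hs.1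
    have : 0 ≤ ((1 - s) * ρ₀ h + s * ρ₁ h) * h := by nlinarith
    exact nonneg_of_mul_nonneg_left this hh')
  rw [hd0, hd1] at hnonneg
  nlinarith

end EVI

end ActionFlow

end

theorem theorem2p2
    {E : Type*} [NormedAddCommGroup E] [NormedSpace ℝ E] [FiniteDimensional ℝ E]
    {X : Type*} [MetricSpace X] [CompleteSpace X] [ChartedSpace E X] [IsManifold 𝓘(ℝ, E) ∞ X]
    [RiemannianBundle (fun x : X => TangentSpace 𝓘(ℝ, E) x)]
    [IsContMDiffRiemannianBundle 𝓘(ℝ, E) ∞ E (fun x : X => TangentSpace 𝓘(ℝ, E) x)]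
    [IsRiemannianManifold 𝓘(ℝ, E) X]
    (F : X → ℝ) (hF : ContMDiff 𝓘(ℝ, E) 𝓘(ℝ, ℝ) ∞ F) (lam : ℝ)
    (S : ℝ → X → X) (hS : ActionFlow.IsSmoothSemigroup E S) :
    ((∀ t : ℝ, 0 ≤ t → ActionFlow.ActionInequalityAt E F lam S t) →
      ActionFlow.SatisfiesEVI F lam S ∧ ActionFlow.IsGradientFlow E F S ∧
        ActionFlow.GeodesicallyConvex F lam) ∧
    (ActionFlow.ActionInequalityAt E F lam S 0 →
      ∀ t : ℝ, 0 ≤ t → ActionFlow.ActionInequalityAt E F lam S t) := by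
  refine ⟨fun h => ?_, fun h t ht => ActionFlow.actionInequalityAt_of_zero hS h ht⟩
  have : LocallyCompactSpace X := Manifold.locallyCompact_of_finiteDimensional 𝓘(ℝ, E)
  have : ProperSpace X := (ActionFlow.hasApproxSplitting E X).properSpace
  exact ⟨ActionFlow.satisfiesEVI_of_actionInequalityAt hS hF h,
    ActionFlow.isGradientFlow_of_actionInequalityAt hS hF (h 0 le_rfl),
    ActionFlow.geodesicallyConvex_of_actionInequalityAt hS hF h⟩
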